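/- All hypergraphs are finite, without repeated edges. Let $H=(V,E)$ be a connected $4$-uniform hypergraph. Assume that $H$ is irreducible, i.e. $H$ does not arise from a hypergraph $H'$ by adding to each edge of $H'$ one new vertex of its own. Let $$\rho(H)=4!\max_{0\ne x\in\mathbb R^V_{\ge 0}}\frac{\sum_{e\in E}\prod_{v\in e}x_v}{\sum_{v\in V}x_v^4},$$ and suppose $\rho(H)\le 6\sqrt[4]{2+\sqrt5}$. Terminology. A path is an alternating sequence $v_0e_1v_1\cdots e_lv_l$ with $v_{i-1},v_i\in e_i$ and with distinct vertices and distinct edges; a cycle is defined in the same way, of length $l\ge2$, with $v_l=v_0$ the only repetition. A hypertree is a connected hypergraph without cycles. For $k\ge 3$, a $k$-branching vertex is a vertex of degree $k$, and a $k$-branching edge is an edge that contains no branching vertex and meets exactly $k$ other edges; branching means $k$-branching for some $k\ge3$. A path of length $m\ge1$ is attached to an edge $e$ at $u\in e$ if there is a path $u=w_0g_1w_1\cdots g_mw_m$ not using $e$ such that $w_0,\dots,w_{m-1}$ have degree $2$ and all other vertices of $g_1,\dots,g_m$ have degree $1$. The $4$-dagger $H_{i,j,k,l}$ is the connected $4$-uniform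 hypergraph consisting of one edge and of paths of lengths $i,j,k,l\ge 1$ attached to it at its four vertices. Then $H$ is a hypertree, every vertex of $H$ has degree at most $3$, and every edge of $H$ meets at most $4$ other edges. Moreover $H$ is an open $4$-quipu or a $4$-dagger, as follows. (Open $4$-quipu.) $H$ is a hypertree, and all branching vertices and branching edges lie on one path $P$. The number of $3$-branching vertices plus the number of $4$-branching edges is at most two. No branching vertex and no $4$-branching edge lies on $P$ between two other branching vertices or branching edges. To each $4$-branching edge there are attached, at three different vertices, paths of lengths $1$, $1$ and $k$ with $k\in\{1,2,3\}$. ($4$-dagger.) $H=H_{i,j,k,l}$ with $1\le i\le j\le k\le l$. Whenever $H$ is a $4$-dagger $H_{i,j,k,l}$ with $i\le j\le k\le l$, it is one of $H_{1,2,2,2}$, $H_{1,2,2,3}$, $H_{1,1,4,4}$, $H_{1,1,4,5}$, or $H_{1,1,k,l}$ with $1\le k\le 3$ and $k\le l$. -/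

import Mathlib

noncomputable section

namespace Hypergraph

variable {α : Type*}

/-- `H` is `r`-uniform: every edge has exactly `r` vertices. -/
def IsUniform (H : Hypergraph α) (r : ℕ) : Prop :=
  ∀ e ∈ H.edgeSet, e.ncard = r

/-- The degree of a vertex: the number of edges containing it. -/
def degree (H : Hypergraph α) (v : α) : ℕ :=
  {e | e ∈ H.edgeSet ∧ v ∈ e}.ncard

/-- The number of edges other than `e` that meet `e`. -/
def edgeDegree (H : Hypergraph α) (e : Set α) : ℕ :=
  {f | f ∈ H.edgeSet ∧ f ≠ e ∧ (f ∩ e).Nonempty}.ncard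

/-- The spectral radius of a finite `r`-uniform hypergraph:
`r!` times the maximum, over nonnegative `x` that do not vanish on the vertex set, of
`(∑_{e edge} ∏_{v ∈ e} x_v) / ∑_{v vertex} x_v ^ r`.
(The quotient is homogeneous and continuous, so the supremum is a maximum when
the vertex set is finite and nonempty.) -/
def spectralRadius (H : Hypergraph α) (r : ℕ) : ℝ :=
  (r.factorial : ℝ) *
    sSup {t : ℝ | ∃ x : α → ℝ, (∀ v, 0 ≤ x v) ∧ (∃ v ∈ H.vertexSet, x v ≠ 0) ∧
      t = (∑ᶠ e ∈ H.edgeSet, ∏ᶠ v ∈ e, x v) / (∑ᶠ v ∈ H.vertexSet, x v ^ r)}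

/-- `H` is extended from `H'`: each edge `e` of `H'` is enlarged by one new vertex `new e`,
where distinct edges receive distinct new vertices. -/
def IsExtensionOf (H H' : Hypergraph α) : Prop :=
  ∃ new : H'.edgeSet → α,
    Function.Injective new ∧
    (∀ e, new e ∉ H'.vertexSet) ∧
    H.vertexSet = H'.vertexSet ∪ Set.range new ∧
    H.edgeSet = Set.range fun e : H'.edgeSet => insert (new e) (e : Set α)

/-- `H` is irreducible if it is not extended from any hypergraph `H'`. -/
def IsIrreducible (H : Hypergraph α) : Prop :=
  ∀ H' : Hypergraph α, ¬ H.IsExtensionOf H'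

/-- A path `v₀ e₁ v₁ e₂ … e_l v_l`: consecutive vertices lie in the edge between them, and all
vertices and all edges are distinct. (`edge i` joins `vert i` and `vert (i + 1)`.) -/
structure Path (H : Hypergraph α) where
  length : ℕ
  vert : Fin (length + 1) → α
  edge : Fin length → Set α
  vert_mem : ∀ i, vert i ∈ H.vertexSet
  edge_mem : ∀ i, edge i ∈ H.edgeSet
  left_mem : ∀ i : Fin length, vert i.castSucc ∈ edge i
  right_mem : ∀ i : Fin length, vert i.succ ∈ edge i
  vert_injective : Function.Injective vert
  edge_injective : Function.Injective edge

/-- Any two vertices are joined by a path. -/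
def IsConnected (H : Hypergraph α) : Prop :=
  ∀ u ∈ H.vertexSet, ∀ v ∈ H.vertexSet,
    ∃ P : H.Path, P.vert 0 = u ∧ P.vert (Fin.last P.length) = v

/-- `H` contains a cycle `v₀ e₀ v₁ e₁ … v_{l-1} e_{l-1} v₀` of some length `l = n + 2 ≥ 2`, with
distinct vertices and distinct edges (`i + 1` is read cyclically in `Fin (n + 2)`). -/
def HasCycle (H : Hypergraph α) : Prop :=
  ∃ (n : ℕ) (v : Fin (n + 2) → α) (e : Fin (n + 2) → Set α),
    Function.Injective v ∧ Function.Injective e ∧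
    ∀ i, e i ∈ H.edgeSet ∧ v i ∈ e i ∧ v (i + 1) ∈ e i

/-- A hypertree: a connected hypergraph without cycles. -/
def IsHypertree (H : Hypergraph α) : Prop :=
  H.IsConnected ∧ ¬ H.HasCycle

/-- A `k`-branching vertex (`k ≥ 3`): a vertex contained in exactly `k` edges. -/
def IsBranchingVertex (H : Hypergraph α) (k : ℕ) (v : α) : Prop :=
  v ∈ H.vertexSet ∧ 3 ≤ k ∧ H.degree v = k

/-- A `k`-branching edge (`k ≥ 3`): an edge that contains no branching vertex and meets exactly
`k` other edges. -/
def IsBranchingEdge (H : Hypergraph α) (k : ℕ) (e : Set α) : Prop :=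
  e ∈ H.edgeSet ∧ 3 ≤ k ∧ (∀ v ∈ e, ∀ m, ¬ H.IsBranchingVertex m v) ∧ H.edgeDegree e = k

/-- A vertex (`inl`) or an edge (`inr`) that is `k`-branching for some `k ≥ 3`. -/
def IsBranching (H : Hypergraph α) : α ⊕ Set α → Prop
  | .inl v => ∃ k, H.IsBranchingVertex k v
  | .inr e => ∃ k, H.IsBranchingEdge k e

/-- A `3`-branching vertex (`inl`) or a `4`-branching edge (`inr`). -/
def IsMajorBranching (H : Hypergraph α) : α ⊕ Set α → Prop
  | .inl v => H.IsBranchingVertex 3 v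
  | .inr e => H.IsBranchingEdge 4 e

/-- In the sequence `v₀ e₁ v₁ e₂ … e_l v_l`, the vertex or edge `x` occurs at place `k`,
counted from `0`. -/
def Path.OccursAt {H : Hypergraph α} (P : H.Path) : α ⊕ Set α → ℕ → Prop
  | .inl v, k => ∃ i, P.vert i = v ∧ k = 2 * (i : ℕ)
  | .inr e, k => ∃ i, P.edge i = e ∧ k = 2 * (i : ℕ) + 1

/-- On the path `P`, `x` comes first, then `y`, then `z`. -/
def Path.InOrder {H : Hypergraph α} (P : H.Path) (x y z : α ⊕ Set α) : Prop :=
  ∃ a b c : ℕ, P.OccursAt x a ∧ P.OccursAt y b ∧ P.OccursAt z c ∧ a < b ∧ b < c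

/-- A path of length `m ≥ 1` is attached to the edge `e` at its vertex `u`: there is a path
`u = w₀ g₁ w₁ … g_m w_m` not using `e` such that `w₀, …, w_{m-1}` have degree `2` (so that `w₀`
lies only in `e` and `g₁`, and `w_i` only in `g_i` and `g_{i+1}`) and all other vertices of
`g₁, …, g_m` have degree `1`. -/
def HasAttachedPath (H : Hypergraph α) (e : Set α) (u : α) (m : ℕ) : Prop :=
  e ∈ H.edgeSet ∧ u ∈ e ∧ 1 ≤ m ∧
    ∃ P : H.Path, P.length = m ∧ P.vert 0 = u ∧ (∀ i, P.edge i ≠ e) ∧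
      (∀ i : Fin P.length, H.degree (P.vert i.castSucc) = 2) ∧
      (∀ i, ∀ w ∈ P.edge i, (∀ j : Fin P.length, w ≠ P.vert j.castSucc) → H.degree w = 1)

/-- Open `4`-quipu. -/
def IsOpenQuipu (H : Hypergraph α) : Prop :=
  H.IsHypertree ∧
  (∃ P : H.Path,
    -- all branching vertices and branching edges lie on the path `P`
    (∀ x, H.IsBranching x → ∃ k, P.OccursAt x k) ∧
    -- no branching vertex or `4`-branching edge lies between two branching vertices or edges
    (∀ x y z, H.IsBranching x → H.IsMajorBranching y → H.IsBranching z → ¬ P.InOrder x y z)) ∧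
  -- there are at most two branching vertices and `4`-branching edges altogether
  {x | H.IsMajorBranching x}.encard ≤ 2 ∧
  -- three paths of lengths `1, 1, k` with `k = 1, 2, 3` are attached to each `4`-branching edge
  (∀ e, H.IsBranchingEdge 4 e →
    ∃ u₁ u₂ u₃ : α, ∃ k : ℕ, u₁ ≠ u₂ ∧ u₁ ≠ u₃ ∧ u₂ ≠ u₃ ∧ 1 ≤ k ∧ k ≤ 3 ∧
      H.HasAttachedPath e u₁ 1 ∧ H.HasAttachedPath e u₂ 1 ∧ H.HasAttachedPath e u₃ k)

/-- `H` is the `4`-dagger `H_{i,j,k,l}`: four paths, of lengths `i, j, k, l`, are attached to the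
four vertices of one edge, and there is nothing else in `H` (since `H` is connected). -/
def IsDagger (H : Hypergraph α) (i j k l : ℕ) : Prop :=
  H.IsConnected ∧
  ∃ e ∈ H.edgeSet, ∃ u : Fin 4 → α, Function.Injective u ∧ Set.range u = e ∧
    H.HasAttachedPath e (u 0) i ∧ H.HasAttachedPath e (u 1) j ∧
    H.HasAttachedPath e (u 2) k ∧ H.HasAttachedPath e (u 3) l

end Hypergraph

end

/-! Let `x` be a maximizer of the Lagrangian with maximum `μ`. Connectedness makes it positive, and
the weights `B v e = (∏_{w∈e} x_w) / (4μ x_v⁴)` on flags sum to 1 at each vertex by the eigenvalue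
equation. In the product over an edge `x` cancels, leaving `(4μ)⁻⁴`, which the bound on the spectral
radius makes at least `1/(2+√5) = √5-2 = τ³`, where `τ = (√5-1)/2`. Only these two facts are kept
(`exists_isSubnormal`); the rest is combinatorics of weights.

Call a flag low if its weight is at most `τ²`. Since `τ³ = τ²·τ` and `1-τ = τ²`, lowness is
inherited by every nonbacktracking step (`low_step`), and an edge entered through a low flag has at
most one exit, of degree 2 (`low_unique`, `low_degree_le_two`). So beyond a low flag there is only a
bare path. Irreducibility yields an edge all of whose vertices have degree at least 2
(`exists_isFullEdge`), and no low flag leads to it. This confines the degrees and rules out cycles.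

A direction that is not low costs the edge it leaves: the weight of that edge at the common vertex
drops below `τ`. An edge can afford two such losses, a full edge only one, and a vertex of degree 3
has at most one flag that is not low. Hence either all directions out of some full edge are low, and
the hypergraph is a dagger, or the flags that are not low trace one path containing all branchings,
with the major ones only at its extremes (`exists_path_isBranching`, `not_inOrder`). The admissible
arm lengths come from inserting the recursive bounds `pathWeight` into the edge product. -/

namespace Hypergraph

/-! ### Perron vector of the Lagrangian -/

section Perron

open Finset

variable {ι : Type*}

/-- The Lagrangian polynomial of a finite family of finite sets. -/
def edgePoly (E : Finset (Finset ι)) (x : ι → ℝ) : ℝ := ∑ e ∈ E, ∏ v ∈ e, x v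

theorem edgePoly_congr {V : Finset ι} {E : Finset (Finset ι)} (hV : ∀ e ∈ E, e ⊆ V) {x y : ι → ℝ}
    (h : ∀ v ∈ V, x v = y v) : edgePoly E x = edgePoly E y :=
  sum_congr rfl fun e he => prod_congr rfl fun v hv => h v (hV e he hv)

theorem edgePoly_smul {E : Finset (Finset ι)} (hc : ∀ e ∈ E, #e = 4) (c : ℝ) (x : ι → ℝ) :
    edgePoly E (fun v => c * x v) = c ^ 4 * edgePoly E x := by
  unfold edgePoly
  rw [mul_sum]
  refine sum_congr rfl fun e he => ?_
  rw [prod_mul_distrib, prod_const, hc e he]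

variable [DecidableEq ι]

/-- The Lagrangian attains its maximum on the nonnegative part of the `ℓ⁴` unit sphere. -/
theorem exists_maximizer {V : Finset ι} (hne : V.Nonempty) {E : Finset (Finset ι)}
    (hV : ∀ e ∈ E, e ⊆ V) (hc : ∀ e ∈ E, #e = 4) :
    ∃ x : ι → ℝ, (∀ v, 0 ≤ x v) ∧ ∑ v ∈ V, x v ^ 4 = 1 ∧
      ∀ y : ι → ℝ, (∀ v, 0 ≤ y v) → edgePoly E y ≤ edgePoly E x * ∑ v ∈ V, y v ^ 4 := by
  -- Coordinates outside `V` are pinned to 0, so `K` is compact even when `ι` is infinite.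
  let K : Set (ι → ℝ) := (Set.univ.pi fun v => if v ∈ V then Set.Icc 0 1 else {0}) ∩
    {x | ∑ v ∈ V, x v ^ 4 = 1}
  have hK : IsCompact K := by
    refine IsCompact.inter_right (isCompact_univ_pi fun v => ?_) ?_
    · split_ifs
      · exact isCompact_Icc
      · exact isCompact_singleton
    · exact isClosed_eq (by fun_prop) continuous_const
  have hmem : ∀ x : ι → ℝ, (∀ v, 0 ≤ x v) → (∀ v ∉ V, x v = 0) → ∑ v ∈ V, x v ^ 4 = 1 → x ∈ K := by
    intro x h0 hz hs
    refine ⟨fun v _ => ?_, hs⟩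
    by_cases hv : v ∈ V
    · simp only [hv, if_true, Set.mem_Icc]
      refine ⟨h0 v, ?_⟩
      have : x v ^ 4 ≤ 1 := by
        rw [← hs]
        exact single_le_sum (f := fun v => x v ^ 4) (fun w _ => by positivity) hv
      exact (pow_le_one_iff_of_nonneg (h0 v) (by norm_num)).1 this
    · simp [hv, hz v hv]
  have hKne : K.Nonempty := by
    obtain ⟨v, hv⟩ := hne
    refine ⟨Pi.single v 1, hmem _ (fun w => ?_) (fun w hw => ?_) ?_⟩
    · by_cases h : w = v
      · subst h; simp
      · simp [h]
    · have : w ≠ v := fun h => hw (h ▸ hv)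
      simp [this]
    · rw [sum_eq_single v]
      · simp
      · intro b _ hb; simp [hb]
      · exact fun h => absurd hv h
  obtain ⟨x, hx, hmax⟩ := hK.exists_isMaxOn hKne (f := edgePoly E)
    (by unfold edgePoly; fun_prop)
  have hx0 : ∀ v, 0 ≤ x v := by
    intro v
    have := hx.1 v trivial
    by_cases hv : v ∈ V
    · simp only [hv, if_true] at this; exact this.1
    · simp only [hv, if_false] at this; exact (Set.mem_singleton_iff.1 this).ge
  refine ⟨x, hx0, hx.2, fun y hy => ?_⟩
  set N := ∑ v ∈ V, y v ^ 4 with hN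
  have hN0 : 0 ≤ N := sum_nonneg fun v _ => by positivity
  rcases hN0.eq_or_lt with h | h
  · have hz : ∀ v ∈ V, y v = 0 := by
      intro v hv
      have := (sum_eq_zero_iff_of_nonneg (fun v _ => by positivity)).1 h.symm v hv
      exact pow_eq_zero_iff (by norm_num) |>.1 this
    have : edgePoly E y = 0 := by
      refine sum_eq_zero fun e he => ?_
      obtain ⟨v, hv⟩ := card_pos.1 (by rw [hc e he]; norm_num : 0 < #e)
      exact prod_eq_zero hv (hz v (hV e he hv))
    rw [this, ← h, mul_zero]
  -- Both sides are homogeneous of degree 4, so `y` may be rescaled to norm 1.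
  · obtain ⟨c, hc0, hc4⟩ : ∃ c : ℝ, 0 < c ∧ c ^ 4 * N = 1 := by
      refine ⟨(N ^ (1 / 4 : ℝ))⁻¹, by positivity, ?_⟩
      rw [inv_pow, ← Real.rpow_natCast, ← Real.rpow_mul h.le]
      norm_num
      exact inv_mul_cancel₀ h.ne'
    let z : ι → ℝ := fun v => if v ∈ V then c * y v else 0
    have hz : z ∈ K := by
      refine hmem z (fun v => ?_) (fun v hv => by simp [z, hv]) ?_
      · simp only [z]; split_ifs
        · exact mul_nonneg hc0.le (hy v)
        · exact le_rfl
      · rw [← hc4, hN, mul_sum]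
        exact sum_congr rfl fun v hv => by simp [z, hv, mul_pow]
    have h1 : edgePoly E z ≤ edgePoly E x := hmax hz
    rw [edgePoly_congr hV (y := fun v => c * y v) (fun v hv => by simp [z, hv]),
      edgePoly_smul hc] at h1
    have : c ^ 4 * edgePoly E y * N ≤ edgePoly E x * N := by gcongr
    calc edgePoly E y = c ^ 4 * N * edgePoly E y := by rw [hc4, one_mul]
      _ = c ^ 4 * edgePoly E y * N := by ring
      _ ≤ _ := this

/-- A maximizer of the Lagrangian of a connected family is positive. -/
theorem maximizer_pos {V : Finset ι} {E : Finset (Finset ι)}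
    (hV : ∀ e ∈ E, e ⊆ V) (hc : ∀ e ∈ E, #e = 4)
    (hcut : ∀ Z ⊆ V, Z.Nonempty → Z ≠ V → ∃ e ∈ E, (∃ v ∈ e, v ∈ Z) ∧ ∃ v ∈ e, v ∉ Z)
    {x : ι → ℝ} (hx0 : ∀ v, 0 ≤ x v) (hx1 : ∑ v ∈ V, x v ^ 4 = 1)
    (hmax : ∀ y : ι → ℝ, (∀ v, 0 ≤ y v) → edgePoly E y ≤ edgePoly E x * ∑ v ∈ V, y v ^ 4) :
    ∀ v ∈ V, 0 < x v := by
  by_contra! hcon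
  obtain ⟨v₀, hv₀, hxv₀⟩ := hcon
  set Z := V.filter fun v => x v = 0 with hZ
  have hv₀Z : v₀ ∈ Z := by simp [hZ, hv₀, le_antisymm hxv₀ (hx0 v₀)]
  have hZV : Z ≠ V := by
    intro h
    have : ∑ v ∈ V, x v ^ 4 = 0 := sum_eq_zero fun v hv => by
      rw [← h] at hv; simp [(mem_filter.1 hv).2]
    rw [hx1] at this; norm_num at this
  obtain ⟨e, he, ⟨a, hae, haZ⟩, ⟨b, hbe, hbZ⟩⟩ := hcut Z (filter_subset _ _) ⟨v₀, hv₀Z⟩ hZV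
  obtain ⟨m, hm0, hm1, hm⟩ : ∃ m : ℝ, 0 < m ∧ m ≤ 1 ∧ ∀ v ∈ V \ Z, m ≤ x v := by
    have hne : (V \ Z).Nonempty := ⟨b, by simp [hbZ, hV e he hbe]⟩
    obtain ⟨w, hw, hmin⟩ := exists_min_image (V \ Z) x hne
    have hw' : 0 < x w := by
      rw [mem_sdiff, hZ, mem_filter] at hw
      exact lt_of_le_of_ne (hx0 w) fun h => hw.2 ⟨hw.1, h.symm⟩
    exact ⟨min (x w) 1, lt_min hw' one_pos, min_le_right _ _,
      fun v hv => (min_le_left _ _).trans (hmin v hv)⟩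
  set μ := edgePoly E x with hμ
  have hμ0 : 0 ≤ μ := sum_nonneg fun e _ => prod_nonneg fun v _ => hx0 v
  -- Raising the zero coordinates to `ε` gains at least `m⁴ε³` on the crossing edge, because its
  -- vertex `b` outside `Z` contributes no factor `ε`; the norm grows only by `#Z·ε⁴`.
  have key : ∀ ε : ℝ, 0 < ε → ε ≤ 1 → m ^ 4 ≤ μ * #Z * ε := by
    intro ε h0 h1
    let y : ι → ℝ := fun v => if v ∈ Z then ε else x v
    have hxy : ∀ v, x v ≤ y v := by
      intro v; simp only [y]; split_ifs with h
      · rw [(mem_filter.1 h).2]; exact h0.le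
      · exact le_rfl
    have hy0 : ∀ v, 0 ≤ y v := fun v => (hx0 v).trans (hxy v)
    have h2 := hmax y hy0
    have h3 : ∑ v ∈ V, y v ^ 4 = 1 + #Z * ε ^ 4 := by
      rw [← hx1, ← sum_sdiff (filter_subset _ V : Z ⊆ V), ← sum_sdiff (filter_subset _ V : Z ⊆ V)]
      have e1 : ∑ v ∈ Z, y v ^ 4 = #Z * ε ^ 4 := by
        rw [sum_congr rfl (g := fun _ => ε ^ 4) (fun v hv => by simp [y, hv])]
        simp
      have e2 : ∑ v ∈ Z, x v ^ 4 = 0 := sum_eq_zero fun v hv => by simp [(mem_filter.1 hv).2]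
      have e3 : ∑ v ∈ V \ Z, y v ^ 4 = ∑ v ∈ V \ Z, x v ^ 4 := sum_congr rfl fun v hv => by
        simp [y, (mem_sdiff.1 hv).2]
      rw [e1, e2, e3, add_zero]
    have h4 : μ + ∏ v ∈ e, y v ≤ edgePoly E y := by
      rw [hμ]
      unfold edgePoly
      rw [← add_sum_erase _ _ he, ← add_sum_erase _ (fun e => ∏ v ∈ e, y v) he,
        prod_eq_zero hae (mem_filter.1 haZ).2, zero_add, add_comm]
      gcongr with f hf v hv
      · exact fun v _ => hx0 v
      · exact hxy v
    have h5 : m ^ 4 * ε ^ 3 ≤ ∏ v ∈ e, y v := by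
      rw [← mul_prod_erase e y hbe]
      have hb : m ≤ y b := (hm b (by simp [hbZ, hV e he hbe])).trans (hxy b)
      have hr : (m * ε) ^ 3 ≤ ∏ v ∈ e.erase b, y v := by
        have hcard : #(e.erase b) = 3 := by rw [card_erase_of_mem hbe, hc e he]
        rw [← hcard, ← prod_const]
        refine prod_le_prod (fun _ _ => by positivity) fun v hv => ?_
        by_cases hvZ : v ∈ Z
        · simp only [y, hvZ, if_true]; nlinarith
        · simp only [y, hvZ, if_false]
          have := hm v (by simp [hvZ, hV e he (mem_of_mem_erase hv)])
          nlinarith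
      calc m ^ 4 * ε ^ 3 = m * (m * ε) ^ 3 := by ring
        _ ≤ _ := mul_le_mul hb hr (by positivity) (hy0 b)
    rw [h3] at h2
    have h6 : m ^ 4 * ε ^ 3 ≤ (μ * #Z * ε) * ε ^ 3 := by nlinarith
    exact le_of_mul_le_mul_right h6 (by positivity)
  set D := μ * #Z
  have hD : 0 ≤ D := by positivity
  have hm4 : 0 < m ^ 4 := by positivity
  have h1 : m ^ 4 ≤ 1 := pow_le_one₀ hm0.le hm1
  -- This `ε` is at most 1 and satisfies `D·ε < m⁴`, contradicting `key`.
  have := key (m ^ 4 / (D + 2)) (by positivity) (by rw [div_le_one (by positivity)]; linarith)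
  rw [mul_div_assoc', le_div_iff₀ (by positivity)] at this
  nlinarith

/-- The eigenvalue equation at a positive maximizer of the Lagrangian. -/
theorem maximizer_eigen {V : Finset ι} {E : Finset (Finset ι)} {x : ι → ℝ} (hx0 : ∀ v, 0 ≤ x v)
    (hx1 : ∑ v ∈ V, x v ^ 4 = 1)
    (hmax : ∀ y : ι → ℝ, (∀ v, 0 ≤ y v) → edgePoly E y ≤ edgePoly E x * ∑ v ∈ V, y v ^ 4)
    {v : ι} (hv : v ∈ V) (hxv : 0 < x v) :
    ∑ e ∈ E with v ∈ e, ∏ w ∈ e, x w = 4 * edgePoly E x * x v ^ 4 := by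
  set μ := edgePoly E x with hμ
  set C := ∑ e ∈ E with v ∈ e, ∏ w ∈ e.erase v, x w with hC
  set A := ∑ e ∈ E with v ∉ e, ∏ w ∈ e, x w with hA
  set D := ∑ w ∈ V.erase v, x w ^ 4 with hD
  have hF : ∀ t, edgePoly E (Function.update x v t) = t * C + A := by
    intro t
    unfold edgePoly
    rw [← sum_filter_add_sum_filter_not E (fun e => v ∈ e), hC, hA, mul_sum]
    congr 1
    · refine sum_congr rfl fun e he => ?_
      rw [← mul_prod_erase e _ (mem_filter.1 he).2, Function.update_self]
      congr 1
      exact prod_congr rfl fun w hw => Function.update_of_ne (ne_of_mem_erase hw) _ _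
    · refine sum_congr rfl fun e he => prod_congr rfl fun w hw => ?_
      exact Function.update_of_ne (fun h : w = v => (mem_filter.1 he).2 (h ▸ hw)) _ _
  have hN : ∀ t, ∑ w ∈ V, Function.update x v t w ^ 4 = t ^ 4 + D := by
    intro t
    rw [← add_sum_erase V _ hv, Function.update_self]
    congr 1
    exact sum_congr rfl fun w hw => by rw [Function.update_of_ne (ne_of_mem_erase hw)]
  have hFx : μ = x v * C + A := by
    rw [← hF, Function.update_eq_self]
  have hNx : 1 = x v ^ 4 + D := by
    rw [← hN, Function.update_eq_self, hx1]
  -- With only the coordinate at `v` varying, the Lagrangian is affine in `t`; maximality says that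
  -- this function is nonnegative near `x v`, where it vanishes.
  have hmin : IsLocalMin (fun t : ℝ => μ * (t ^ 4 + D) - (t * C + A)) (x v) := by
    filter_upwards [lt_mem_nhds hxv] with t ht
    have := hmax (Function.update x v t) (by
      intro w
      by_cases h : w = v
      · subst h; simpa using ht.le
      · simpa [h] using hx0 w)
    rw [hF, hN] at this
    rw [← hNx, ← hFx]
    linarith
  have hder : HasDerivAt (fun t : ℝ => μ * (t ^ 4 + D) - (t * C + A))
      (μ * (4 * x v ^ 3) - C) (x v) := by
    have h1 := (((hasDerivAt_pow 4 (x v)).add_const D).const_mul μ).sub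
      (((hasDerivAt_id (x v)).mul_const C).add_const A)
    exact h1.congr_deriv (by norm_num)
  have h0 := hmin.hasDerivAt_eq_zero hder
  have h1 : ∑ e ∈ E with v ∈ e, ∏ w ∈ e, x w = x v * C := by
    rw [hC, mul_sum]
    exact sum_congr rfl fun e he => (mul_prod_erase e x (mem_filter.1 he).2).symm
  rw [h1, show C = μ * (4 * x v ^ 3) by linarith]
  ring

end Perron

/-! ### Subnormal weightings from the spectral bound -/

variable {α : Type*}

/-- The reciprocal of the golden ratio. -/
noncomputable def tau : ℝ := (Real.sqrt 5 - 1) / 2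

theorem tau_sq : tau ^ 2 = 1 - tau := by
  have := Real.sq_sqrt (show (0 : ℝ) ≤ 5 by norm_num)
  unfold tau; nlinarith

theorem tau_lower : 0.618033 < tau := by
  have : (2.236066 : ℝ) < Real.sqrt 5 := Real.lt_sqrt_of_sq_lt (by norm_num)
  unfold tau; linarith

theorem tau_upper : tau < 0.618034 := by
  have : Real.sqrt 5 < 2.236068 := (Real.sqrt_lt' (by norm_num)).2 (by norm_num)
  unfold tau; linarith

/-- A weighting `B` of the flags of `H` whose sums at the vertices are at most `1` and whose
products over the edges are at least `2 τ - 1 = τ ^ 3`. -/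
structure IsSubnormal (H : Hypergraph α) (B : α → Set α → ℝ) : Prop where
  pos : ∀ e ∈ H.edgeSet, ∀ v ∈ e, 0 < B v e
  sum_le : ∀ v, ∀ S : Finset (Set α), (∀ e ∈ S, e ∈ H.edgeSet ∧ v ∈ e) → ∑ e ∈ S, B v e ≤ 1
  prod_ge : ∀ e ∈ H.edgeSet, 2 * tau - 1 ≤ ∏ᶠ v ∈ e, B v e

theorem finite_edgeSet {H : Hypergraph α} (hfin : H.vertexSet.Finite) : H.edgeSet.Finite :=
  hfin.finite_subsets.subset fun _ he => H.subset_vertexSet_of_mem_edgeSet' he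

/-- In a connected hypergraph some edge crosses every cut. -/
theorem IsConnected.exists_crossing {H : Hypergraph α} (hconn : H.IsConnected) {Z : Set α}
    {u w : α} (hu : u ∈ H.vertexSet) (hw : w ∈ H.vertexSet) (huZ : u ∈ Z) (hwZ : w ∉ Z) :
    ∃ e ∈ H.edgeSet, (∃ v ∈ e, v ∈ Z) ∧ ∃ v ∈ e, v ∉ Z := by
  obtain ⟨P, h0, h1⟩ := hconn u hu w hw
  by_contra! hcon
  have : ∀ i, P.vert i ∈ Z := by
    intro i
    induction i using Fin.induction with
    | zero => rwa [h0]
    | succ i ih => exact hcon _ (P.edge_mem i) ⟨_, P.left_mem i, ih⟩ _ (P.right_mem i)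
  exact hwZ (h1 ▸ this _)

/-- This is the only place where the spectral radius enters; afterwards only the vertex sums and
edge products of the weights matter. -/
theorem exists_isSubnormal {H : Hypergraph α} (hfin : H.vertexSet.Finite)
    (hunif : H.IsUniform 4) (hconn : H.IsConnected) (hE : H.edgeSet.Nonempty)
    (hrho : H.spectralRadius 4 ≤ 6 * (2 + Real.sqrt 5) ^ (1 / 4 : ℝ)) :
    ∃ B, H.IsSubnormal B := by
  classical
  have hEfin := finite_edgeSet hfin
  set V : Finset α := hfin.toFinset with hVdef
  let F : Set α → Finset α := fun e => V.filter (· ∈ e)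
  have hF : ∀ e ∈ H.edgeSet, (F e : Set α) = e := by
    intro e he
    ext v
    simp only [F, Finset.coe_filter, Set.mem_ofPred_eq, hVdef, Set.Finite.mem_toFinset]
    exact ⟨fun h => h.2, fun h => ⟨H.subset_vertexSet_of_mem_edgeSet' he h, h⟩⟩
  have hmemF : ∀ e ∈ H.edgeSet, ∀ v, v ∈ F e ↔ v ∈ e := by
    intro e he v
    rw [← Finset.mem_coe, hF e he]
  set E : Finset (Finset α) := hEfin.toFinset.image F with hEdef
  have hinj : Set.InjOn F hEfin.toFinset := by
    intro e he f hf h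
    rw [← hF e (by simpa using he), ← hF f (by simpa using hf), h]
  have hprod : ∀ e ∈ H.edgeSet, ∀ f : α → ℝ, ∏ᶠ v ∈ e, f v = ∏ v ∈ F e, f v := by
    intro e he f
    conv_lhs => rw [← hF e he]
    exact finprod_mem_coe_finset f (F e)
  have hpoly : ∀ x : α → ℝ, ∑ᶠ e ∈ H.edgeSet, ∏ᶠ v ∈ e, x v = edgePoly E x := by
    intro x
    rw [finsum_mem_eq_finite_toFinset_sum _ hEfin, edgePoly, hEdef, Finset.sum_image hinj]
    exact Finset.sum_congr rfl fun e he => hprod e (by simpa using he) x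
  have hnorm : ∀ x : α → ℝ, ∑ᶠ v ∈ H.vertexSet, x v ^ 4 = ∑ v ∈ V, x v ^ 4 := fun x =>
    finsum_mem_eq_finite_toFinset_sum _ hfin
  have hEV : ∀ e ∈ E, e ⊆ V := by
    intro e he
    obtain ⟨f, -, rfl⟩ := Finset.mem_image.1 he
    exact Finset.filter_subset _ _
  have hEc : ∀ e ∈ E, e.card = 4 := by
    intro e he
    obtain ⟨f, hf, rfl⟩ := Finset.mem_image.1 he
    have hf' : f ∈ H.edgeSet := by simpa using hf
    rw [← Set.ncard_coe_finset, hF f hf', hunif f hf']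
  obtain ⟨e₀, he₀⟩ := hE
  have hVne : V.Nonempty := by
    have h0 : F e₀ ∈ E := Finset.mem_image_of_mem F (by simpa using he₀)
    have : 0 < (F e₀).card := by rw [hEc _ h0]; norm_num
    obtain ⟨v, hv⟩ := Finset.card_pos.1 this
    exact ⟨v, hEV _ h0 hv⟩
  have hcut : ∀ Z ⊆ V, Z.Nonempty → Z ≠ V → ∃ e ∈ E, (∃ v ∈ e, v ∈ Z) ∧ ∃ v ∈ e, v ∉ Z := by
    intro Z hZV ⟨u, hu⟩ hne
    obtain ⟨w, hwV, hwZ⟩ : ∃ w ∈ V, w ∉ Z := by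
      by_contra! h; exact hne (Finset.Subset.antisymm hZV h)
    obtain ⟨e, he, ⟨a, ha, haZ⟩, b, hb, hbZ⟩ := hconn.exists_crossing (Z := (Z : Set α))
      (by simpa [hVdef] using hZV hu) (by simpa [hVdef] using hwV) hu hwZ
    exact ⟨F e, Finset.mem_image_of_mem F (by simpa using he),
      ⟨a, (hmemF e he a).2 ha, haZ⟩, b, (hmemF e he b).2 hb, hbZ⟩
  obtain ⟨x, hx0, hx1, hmax⟩ := exists_maximizer hVne hEV hEc
  have hpos := maximizer_pos hEV hEc hcut hx0 hx1 hmax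
  set μ := edgePoly E x with hμ
  have hposE : ∀ e ∈ H.edgeSet, ∀ v ∈ e, 0 < x v := fun e he v hv =>
    hpos v (by simpa [hVdef] using H.subset_vertexSet_of_mem_edgeSet' he hv)
  have hμ0 : 0 < μ := by
    have h0 : F e₀ ∈ E := Finset.mem_image_of_mem F (by simpa using he₀)
    refine Finset.sum_pos (fun e he => Finset.prod_pos fun v hv => hpos v (hEV e he hv)) ⟨_, h0⟩
  have hμle : μ ≤ sSup {t : ℝ | ∃ x : α → ℝ, (∀ v, 0 ≤ x v) ∧ (∃ v ∈ H.vertexSet, x v ≠ 0) ∧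
      t = (∑ᶠ e ∈ H.edgeSet, ∏ᶠ v ∈ e, x v) / (∑ᶠ v ∈ H.vertexSet, x v ^ 4)} := by
    refine le_csSup ⟨μ, ?_⟩ ⟨x, hx0, ?_, ?_⟩
    · rintro t ⟨y, hy0, -, rfl⟩
      rw [hpoly, hnorm]
      exact div_le_of_le_mul₀ (Finset.sum_nonneg fun v _ => by have := hy0 v; positivity) hμ0.le
        (hmax y hy0)
    · obtain ⟨v, hv⟩ := hVne
      exact ⟨v, by simpa [hVdef] using hv, (hpos v hv).ne'⟩
    · rw [hpoly, hnorm, hx1, div_one]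
  -- From `24μ ≤ ρ` one gets `(4μ)⁴ ≤ 2+√5`, and `2τ-1 = √5-2` is the inverse of `2+√5`.
  have hlam : (4 * μ) ^ 4 * (2 * tau - 1) ≤ 1 := by
    have h1 : 4 * μ ≤ (2 + Real.sqrt 5) ^ (1 / 4 : ℝ) := by
      have h2 : (24 : ℝ) * μ ≤ H.spectralRadius 4 := by
        unfold spectralRadius
        have : ((Nat.factorial 4 : ℕ) : ℝ) = 24 := by norm_num [Nat.factorial]
        rw [this]
        linarith
      linarith
    have h5 : (0 : ℝ) ≤ 2 + Real.sqrt 5 := by positivity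
    have h3 : (4 * μ) ^ 4 ≤ 2 + Real.sqrt 5 := by
      calc (4 * μ) ^ 4 ≤ ((2 + Real.sqrt 5) ^ (1 / 4 : ℝ)) ^ 4 := by gcongr
        _ = 2 + Real.sqrt 5 := by
          rw [← Real.rpow_natCast, ← Real.rpow_mul h5]; norm_num
    have h4 : 0 ≤ 2 * tau - 1 := by have := tau_lower; linarith
    calc (4 * μ) ^ 4 * (2 * tau - 1) ≤ (2 + Real.sqrt 5) * (2 * tau - 1) := by gcongr
      _ = 1 := by
        have := Real.sq_sqrt (show (0 : ℝ) ≤ 5 by norm_num)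
        unfold tau; nlinarith
  have hB : ∀ e ∈ H.edgeSet, ∀ v ∈ e, 0 < ∏ᶠ w ∈ e, x w := by
    intro e he v hv
    rw [hprod e he]
    exact Finset.prod_pos fun w hw => hposE e he w ((hmemF e he w).1 hw)
  refine ⟨fun v e => (∏ᶠ w ∈ e, x w) / (4 * μ * x v ^ 4), fun e he v hv => ?_, fun v S hS => ?_,
    fun e he => ?_⟩
  · have := hposE e he v hv
    have := hB e he v hv
    positivity
  · rcases S.eq_empty_or_nonempty with rfl | ⟨f, hf⟩
    · simp
    have hv : 0 < x v := hposE f (hS f hf).1 v (hS f hf).2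
    have hvV : v ∈ V := by
      simpa [hVdef] using H.subset_vertexSet_of_mem_edgeSet' (hS f hf).1 (hS f hf).2
    rw [← Finset.sum_div, div_le_one (by positivity), ← maximizer_eigen hx0 hx1 hmax hvV hv]
    have hSinj : Set.InjOn F S := hinj.mono fun e he => by simpa using (hS e he).1
    rw [Finset.sum_congr rfl fun e he => hprod e (hS e he).1 x,
      ← Finset.sum_image (f := fun e => ∏ w ∈ e, x w) hSinj]
    refine Finset.sum_le_sum_of_subset_of_nonneg (fun e he => ?_)
      fun e he _ => Finset.prod_nonneg fun w _ => hx0 w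
    obtain ⟨g, hg, rfl⟩ := Finset.mem_image.1 he
    exact Finset.mem_filter.2 ⟨Finset.mem_image_of_mem F (by simpa using (hS g hg).1),
      (hmemF g (hS g hg).1 v).2 (hS g hg).2⟩
  · have hcard : (F e).card = 4 := hEc _ (Finset.mem_image_of_mem F (by simpa using he))
    have hp : 0 < ∏ w ∈ F e, x w :=
      Finset.prod_pos fun w hw => hposE e he w ((hmemF e he w).1 hw)
    rw [hprod e he, hprod e he, Finset.prod_div_distrib, Finset.prod_const, Finset.prod_mul_distrib,
      Finset.prod_const, Finset.prod_pow, hcard, le_div_iff₀ (by positivity)]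
    nlinarith [pow_pos hp 4]

/-! ### Choosing vertices of a 4-element edge -/

variable {H : Hypergraph α} {B : α → Set α → ℝ}

theorem IsUniform.finite_edge (hunif : H.IsUniform 4) {e : Set α} (he : e ∈ H.edgeSet) :
    e.Finite := Set.finite_of_ncard_pos (by rw [hunif e he]; norm_num)

theorem IsUniform.exists_ne₁ (hunif : H.IsUniform 4) {e : Set α} (he : e ∈ H.edgeSet) (a : α) :
    ∃ b ∈ e, b ≠ a := by
  obtain ⟨b, hb, hba⟩ := Set.exists_mem_notMem_of_ncard_lt_ncard (s := {a}) (t := e)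
    (by rw [hunif e he, Set.ncard_singleton]; norm_num)
  exact ⟨b, hb, hba⟩

theorem IsUniform.exists_ne₂ (hunif : H.IsUniform 4) {e : Set α} (he : e ∈ H.edgeSet) (a b : α) :
    ∃ c ∈ e, c ≠ a ∧ c ≠ b := by
  obtain ⟨c, hc, hcab⟩ := Set.exists_mem_notMem_of_ncard_lt_ncard (s := {a, b}) (t := e)
    (by rw [hunif e he]; have := Set.ncard_insert_le a {b}; rw [Set.ncard_singleton] at this; omega)
  exact ⟨c, hc, by simpa using hcab⟩

theorem IsUniform.exists_ne₃ (hunif : H.IsUniform 4) {e : Set α} (he : e ∈ H.edgeSet)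
    (a b c : α) : ∃ d ∈ e, d ≠ a ∧ d ≠ b ∧ d ≠ c := by
  obtain ⟨d, hd, hdabc⟩ := Set.exists_mem_notMem_of_ncard_lt_ncard (s := {a, b, c}) (t := e)
    (by
      rw [hunif e he]
      have h1 := Set.ncard_insert_le a {b, c}
      have h2 := Set.ncard_insert_le b {c}
      rw [Set.ncard_singleton] at h2
      omega)
  exact ⟨d, hd, by simpa using hdabc⟩

theorem IsUniform.eq_of_mem (hunif : H.IsUniform 4) {e : Set α} (he : e ∈ H.edgeSet)
    {a b c d : α} (ha : a ∈ e) (hb : b ∈ e) (hc : c ∈ e) (hd : d ∈ e) (hab : a ≠ b) (hac : a ≠ c)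
    (had : a ≠ d) (hbc : b ≠ c) (hbd : b ≠ d) (hcd : c ≠ d) : e = {a, b, c, d} := by
  classical
  symm
  refine Set.eq_of_subset_of_ncard_le ?_ ?_ (hunif.finite_edge he)
  · rintro x (rfl | rfl | rfl | rfl) <;> assumption
  · rw [hunif e he, Set.ncard_insert_of_notMem (by simp [*]), Set.ncard_insert_of_notMem
      (by simp [*]), Set.ncard_pair hcd]

theorem IsUniform.exists_four (hunif : H.IsUniform 4) {e : Set α} (he : e ∈ H.edgeSet) :
    ∃ a b c d : α, a ∈ e ∧ b ∈ e ∧ c ∈ e ∧ d ∈ e ∧ a ≠ b ∧ a ≠ c ∧ a ≠ d ∧ b ≠ c ∧ b ≠ d ∧ c ≠ d := by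
  obtain ⟨a, ha⟩ := Set.nonempty_of_ncard_ne_zero (s := e) (by rw [hunif e he]; norm_num)
  obtain ⟨b, hb, hba⟩ := hunif.exists_ne₁ he a
  obtain ⟨c, hc, hca, hcb⟩ := hunif.exists_ne₂ he a b
  obtain ⟨d, hd, hda, hdb, hdc⟩ := hunif.exists_ne₃ he a b c
  exact ⟨a, b, c, d, ha, hb, hc, hd, hba.symm, hca.symm, hda.symm, hcb.symm, hdb.symm, hdc.symm⟩

/-! ### Degrees -/

theorem finite_star (hfin : H.vertexSet.Finite) (v : α) :
    {e | e ∈ H.edgeSet ∧ v ∈ e}.Finite :=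
  (finite_edgeSet hfin).subset fun _ h => h.1

theorem one_le_degree (hfin : H.vertexSet.Finite) {v : α} {e : Set α} (he : e ∈ H.edgeSet)
    (hv : v ∈ e) : 1 ≤ H.degree v :=
  (Set.ncard_pos (finite_star hfin v)).2 ⟨e, he, hv⟩

theorem two_le_degree (hfin : H.vertexSet.Finite) {v : α} {e f : Set α} (he : e ∈ H.edgeSet)
    (hv : v ∈ e) (hf : f ∈ H.edgeSet) (hvf : v ∈ f) (hef : e ≠ f) : 2 ≤ H.degree v :=
  (Set.one_lt_ncard (finite_star hfin v)).2 ⟨e, ⟨he, hv⟩, f, ⟨hf, hvf⟩, hef⟩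

theorem three_le_degree (hfin : H.vertexSet.Finite) {v : α} {e f g : Set α} (he : e ∈ H.edgeSet)
    (hv : v ∈ e) (hf : f ∈ H.edgeSet) (hvf : v ∈ f) (hg : g ∈ H.edgeSet) (hvg : v ∈ g)
    (hef : e ≠ f) (heg : e ≠ g) (hfg : f ≠ g) : 3 ≤ H.degree v :=
  (Set.two_lt_ncard (finite_star hfin v)).2 ⟨e, ⟨he, hv⟩, f, ⟨hf, hvf⟩, g, ⟨hg, hvg⟩, hef, heg, hfg⟩

theorem exists_edge_ne {v : α} (h : 2 ≤ H.degree v) (e : Set α) :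
    ∃ f ∈ H.edgeSet, v ∈ f ∧ f ≠ e := by
  obtain ⟨f, hf, hfe⟩ := Set.exists_ne_of_one_lt_ncard h e
  exact ⟨f, hf.1, hf.2, hfe⟩

theorem exists_edge_ne₂ {v : α} (h : 3 ≤ H.degree v) (e f : Set α) :
    ∃ g ∈ H.edgeSet, v ∈ g ∧ g ≠ e ∧ g ≠ f := by
  obtain ⟨g, hg, hgef⟩ := Set.exists_mem_notMem_of_ncard_lt_ncard (s := {e, f})
    (t := {e | e ∈ H.edgeSet ∧ v ∈ e}) (by
      have := Set.ncard_insert_le e {f}; rw [Set.ncard_singleton] at this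
      unfold degree at h; omega)
  exact ⟨g, hg.1, hg.2, by simpa using hgef⟩

theorem exists_edge_ne₃ {v : α} (h : 4 ≤ H.degree v) (e f g : Set α) :
    ∃ k ∈ H.edgeSet, v ∈ k ∧ k ≠ e ∧ k ≠ f ∧ k ≠ g := by
  obtain ⟨k, hk, hkefg⟩ := Set.exists_mem_notMem_of_ncard_lt_ncard (s := {e, f, g})
    (t := {e | e ∈ H.edgeSet ∧ v ∈ e}) (by
      have h1 := Set.ncard_insert_le e {f, g}
      have h2 := Set.ncard_insert_le f {g}
      rw [Set.ncard_singleton] at h2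
      unfold degree at h; omega)
  exact ⟨k, hk.1, hk.2, by simpa using hkefg⟩

theorem edgeDegree_add_four_le (hfin : H.vertexSet.Finite) {a b c d : α}
    (he : {a, b, c, d} ∈ H.edgeSet) :
    H.edgeDegree {a, b, c, d} + 4 ≤ H.degree a + H.degree b + H.degree c + H.degree d := by
  set e : Set α := {a, b, c, d} with hdef
  let A : α → Set (Set α) := fun v => {f | f ∈ H.edgeSet ∧ v ∈ f} \ {e}
  have hA : ∀ v ∈ e, (A v).ncard + 1 = H.degree v := fun v hv =>
    Set.ncard_sdiff_singleton_add_one (s := {f | f ∈ H.edgeSet ∧ v ∈ f}) ⟨he, hv⟩ (finite_star hfin v)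
  have hsub : {f | f ∈ H.edgeSet ∧ f ≠ e ∧ (f ∩ e).Nonempty} ⊆ A a ∪ A b ∪ A c ∪ A d := by
    rintro f ⟨hf, hfe, v, hvf, hve⟩
    rcases hve with rfl | rfl | rfl | rfl
    · exact Or.inl (Or.inl (Or.inl ⟨⟨hf, hvf⟩, hfe⟩))
    · exact Or.inl (Or.inl (Or.inr ⟨⟨hf, hvf⟩, hfe⟩))
    · exact Or.inl (Or.inr ⟨⟨hf, hvf⟩, hfe⟩)
    · exact Or.inr ⟨⟨hf, hvf⟩, hfe⟩
  have hfinA : (A a ∪ A b ∪ A c ∪ A d).Finite :=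
    (finite_edgeSet hfin).subset (by rintro f (((h | h) | h) | h) <;> exact h.1.1)
  have h1 : H.edgeDegree e ≤ (A a ∪ A b ∪ A c ∪ A d).ncard := Set.ncard_le_ncard hsub hfinA
  have h2 := Set.ncard_union_le (A a ∪ A b ∪ A c) (A d)
  have h3 := Set.ncard_union_le (A a ∪ A b) (A c)
  have h4 := Set.ncard_union_le (A a) (A b)
  have ha := hA a (by simp [hdef])
  have hb := hA b (by simp [hdef])
  have hc := hA c (by simp [hdef])
  have hd := hA d (by simp [hdef])
  omega

/-! ### Elementary consequences of subnormality -/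

namespace IsSubnormal

variable (hB : H.IsSubnormal B)
include hB

theorem le_one {v : α} {e : Set α} (he : e ∈ H.edgeSet) (hv : v ∈ e) : B v e ≤ 1 := by
  simpa using hB.sum_le v {e} (by simp [he, hv])

theorem add_le {v : α} {e f : Set α} (he : e ∈ H.edgeSet) (hve : v ∈ e) (hf : f ∈ H.edgeSet)
    (hvf : v ∈ f) (hef : e ≠ f) : B v e + B v f ≤ 1 := by
  classical
  have := hB.sum_le v {e, f} (by simp [*])
  rwa [Finset.sum_pair hef] at this

theorem add_add_le {v : α} {e f g : Set α} (he : e ∈ H.edgeSet) (hve : v ∈ e)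
    (hf : f ∈ H.edgeSet) (hvf : v ∈ f) (hg : g ∈ H.edgeSet) (hvg : v ∈ g) (hef : e ≠ f)
    (heg : e ≠ g) (hfg : f ≠ g) : B v e + B v f + B v g ≤ 1 := by
  classical
  have := hB.sum_le v {e, f, g} (by simp [*])
  rw [Finset.sum_insert (by simp [*]), Finset.sum_pair hfg] at this
  linarith

theorem add_add_add_le {v : α} {e f g k : Set α} (he : e ∈ H.edgeSet) (hve : v ∈ e)
    (hf : f ∈ H.edgeSet) (hvf : v ∈ f) (hg : g ∈ H.edgeSet) (hvg : v ∈ g) (hk : k ∈ H.edgeSet)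
    (hvk : v ∈ k) (hef : e ≠ f) (heg : e ≠ g) (hek : e ≠ k) (hfg : f ≠ g) (hfk : f ≠ k)
    (hgk : g ≠ k) : B v e + B v f + B v g + B v k ≤ 1 := by
  classical
  have := hB.sum_le v {e, f, g, k} (by simp [*])
  rw [Finset.sum_insert (by simp [*]), Finset.sum_insert (by simp [*]), Finset.sum_pair hgk] at this
  linarith

variable (hunif : H.IsUniform 4)
include hunif

theorem le_mul₄ {e : Set α} (he : e ∈ H.edgeSet) {a b c d : α} (ha : a ∈ e) (hb : b ∈ e)
    (hc : c ∈ e) (hd : d ∈ e) (hab : a ≠ b) (hac : a ≠ c) (had : a ≠ d) (hbc : b ≠ c)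
    (hbd : b ≠ d) (hcd : c ≠ d) : 2 * tau - 1 ≤ B a e * B b e * B c e * B d e := by
  classical
  have h := hB.prod_ge e he
  have h1 : e = ((({a, b, c, d} : Finset α)) : Set α) := by
    rw [hunif.eq_of_mem he ha hb hc hd hab hac had hbc hbd hcd]; simp
  have h2 : ∏ᶠ v ∈ e, B v e = ∏ v ∈ ({a, b, c, d} : Finset α), B v e := by
    rw [← finprod_mem_coe_finset (fun v => B v e), ← h1]
  rw [h2, Finset.prod_insert (by simp [*]), Finset.prod_insert (by simp [*]),
    Finset.prod_pair hcd] at h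
  linarith

theorem le_mul₃ {e : Set α} (he : e ∈ H.edgeSet) {a b c : α} (ha : a ∈ e) (hb : b ∈ e)
    (hc : c ∈ e) (hab : a ≠ b) (hac : a ≠ c) (hbc : b ≠ c) :
    2 * tau - 1 ≤ B a e * B b e * B c e := by
  obtain ⟨d, hd, hda, hdb, hdc⟩ := hunif.exists_ne₃ he a b c
  refine (hB.le_mul₄ hunif he ha hb hc hd hab hac hda.symm hbc hdb.symm hdc.symm).trans ?_
  have := hB.pos e he
  exact mul_le_of_le_one_right (mul_pos (mul_pos (this a ha) (this b hb)) (this c hc)).le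
    (hB.le_one he hd)

theorem le_mul₂ {e : Set α} (he : e ∈ H.edgeSet) {a b : α} (ha : a ∈ e) (hb : b ∈ e)
    (hab : a ≠ b) : 2 * tau - 1 ≤ B a e * B b e := by
  obtain ⟨d, hd, hda, hdb⟩ := hunif.exists_ne₂ he a b
  refine (hB.le_mul₃ hunif he ha hb hd hab hda.symm hdb.symm).trans ?_
  have := hB.pos e he
  exact mul_le_of_le_one_right (mul_pos (this a ha) (this b hb)).le (hB.le_one he hd)

theorem le_apply {e : Set α} (he : e ∈ H.edgeSet) {a : α} (ha : a ∈ e) : 2 * tau - 1 ≤ B a e := by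
  obtain ⟨d, hd, hda⟩ := hunif.exists_ne₁ he a
  refine (hB.le_mul₂ hunif he ha hd hda.symm).trans ?_
  exact mul_le_of_le_one_right (hB.pos e he a ha).le (hB.le_one he hd)

/-- Each further edge at `v` has weight at least `τ³` there, so one of them leaves at most `1-τ³ =
2-2τ`, and two leave at most `1-2τ³ = 3-4τ`. -/
theorem le_of_two_le_degree {v : α} {e : Set α} (he : e ∈ H.edgeSet) (hv : v ∈ e)
    (h : 2 ≤ H.degree v) : B v e ≤ 2 - 2 * tau := by
  obtain ⟨f, hf, hvf, hfe⟩ := exists_edge_ne h e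
  have := hB.add_le he hv hf hvf hfe.symm
  have := hB.le_apply hunif hf hvf
  linarith

theorem le_of_three_le_degree {v : α} {e : Set α} (he : e ∈ H.edgeSet) (hv : v ∈ e)
    (h : 3 ≤ H.degree v) : B v e ≤ 3 - 4 * tau := by
  obtain ⟨f, hf, hvf, hfe⟩ := exists_edge_ne (by omega : 2 ≤ H.degree v) e
  obtain ⟨g, hg, hvg, hge, hgf⟩ := exists_edge_ne₂ h e f
  have := hB.add_add_le he hv hf hvf hg hvg hfe.symm hge.symm hgf.symm
  have := hB.le_apply hunif hf hvf
  have := hB.le_apply hunif hg hvg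
  linarith

end IsSubnormal

/-! ### Degree patterns excluded on an edge -/

theorem mul₃_le {a b c x y z : ℝ} (ha : 0 < a) (hb : 0 < b) (hc : 0 < c) (hax : a ≤ x)
    (hby : b ≤ y) (hcz : c ≤ z) : a * b * c ≤ x * y * z := by
  have : 0 < x := ha.trans_le hax
  have : 0 < y := hb.trans_le hby
  gcongr

theorem mul₄_le {a b c d x y z w : ℝ} (ha : 0 < a) (hb : 0 < b) (hc : 0 < c) (hd : 0 < d)
    (hax : a ≤ x) (hby : b ≤ y) (hcz : c ≤ z) (hdw : d ≤ w) :
    a * b * c * d ≤ x * y * z * w := by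
  have : 0 < x := ha.trans_le hax
  have : 0 < y := hb.trans_le hby
  have : 0 < z := hc.trans_le hcz
  gcongr

theorem tau_pow_three : tau ^ 3 = 2 * tau - 1 := by
  linear_combination (tau - 1) * tau_sq

namespace IsSubnormal

variable (hB : H.IsSubnormal B) (hunif : H.IsUniform 4)
include hB hunif

/-- A narrow margin: `(1-2τ³)(1-τ³)³ ≈ 0.2353` against `τ³ ≈ 0.2361`. -/
theorem false_of_degrees_3222 {e : Set α} (he : e ∈ H.edgeSet) {a b c d : α} (ha : a ∈ e)
    (hb : b ∈ e) (hc : c ∈ e) (hd : d ∈ e) (hab : a ≠ b) (hac : a ≠ c) (had : a ≠ d) (hbc : b ≠ c)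
    (hbd : b ≠ d) (hcd : c ≠ d) (h3 : 3 ≤ H.degree a) (h2b : 2 ≤ H.degree b)
    (h2c : 2 ≤ H.degree c) (h2d : 2 ≤ H.degree d) : False := by
  have h := hB.le_mul₄ hunif he ha hb hc hd hab hac had hbc hbd hcd
  have hp := hB.pos e he
  have h' := mul₄_le (hp a ha) (hp b hb) (hp c hc) (hp d hd)
    (hB.le_of_three_le_degree hunif he ha h3) (hB.le_of_two_le_degree hunif he hb h2b)
    (hB.le_of_two_le_degree hunif he hc h2c) (hB.le_of_two_le_degree hunif he hd h2d)
  have h1 : (3 - 4 * tau) * (2 - 2 * tau) * (2 - 2 * tau) * (2 - 2 * tau) = 376 - 608 * tau := by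
    linear_combination (32 * tau ^ 2 - 152 * tau + 352) * tau_sq
  have := tau_lower
  linarith

theorem false_of_degrees_332 {e : Set α} (he : e ∈ H.edgeSet) {a b c : α} (ha : a ∈ e)
    (hb : b ∈ e) (hc : c ∈ e) (hab : a ≠ b) (hac : a ≠ c) (hbc : b ≠ c) (h3 : 3 ≤ H.degree a)
    (h3b : 3 ≤ H.degree b) (h2c : 2 ≤ H.degree c) : False := by
  have h := hB.le_mul₃ hunif he ha hb hc hab hac hbc
  have hp := hB.pos e he
  have h' := mul₃_le (hp a ha) (hp b hb) (hp c hc)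
    (hB.le_of_three_le_degree hunif he ha h3) (hB.le_of_three_le_degree hunif he hb h3b)
    (hB.le_of_two_le_degree hunif he hc h2c)
  have h1 : (3 - 4 * tau) * (3 - 4 * tau) * (2 - 2 * tau) = 130 - 210 * tau := by
    linear_combination (112 - 32 * tau) * tau_sq
  have := tau_lower
  linarith

/-- Five neighbouring edges would force the four degrees to sum to at least 9. With degrees at most
3 this requires a vertex of degree 3 together with either three others of degree at least 2, or
another of degree 3 and one of degree at least 2; both patterns are excluded. -/
theorem edgeDegree_le_four (hfin : H.vertexSet.Finite) (h3 : ∀ v ∈ H.vertexSet, H.degree v ≤ 3)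
    {e : Set α} (he : e ∈ H.edgeSet) : H.edgeDegree e ≤ 4 := by
  by_contra! hcon
  obtain ⟨a, b, c, d, ha, hb, hc, hd, hab, hac, had, hbc, hbd, hcd⟩ := hunif.exists_four he
  have heq := hunif.eq_of_mem he ha hb hc hd hab hac had hbc hbd hcd
  have hsum := edgeDegree_add_four_le hfin (heq ▸ he)
  rw [← heq] at hsum
  have hle : ∀ v ∈ e, H.degree v ≤ 3 := fun v hv => h3 v (H.subset_vertexSet_of_mem_edgeSet' he hv)
  have := hle a ha
  have := hle b hb
  have := hle c hc
  have := hle d hd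
  have h322 : ∀ x ∈ e, ∀ y ∈ e, ∀ z ∈ e, ∀ w ∈ e, x ≠ y → x ≠ z → x ≠ w → y ≠ z → y ≠ w → z ≠ w →
      ¬ (3 ≤ H.degree x ∧ 2 ≤ H.degree y ∧ 2 ≤ H.degree z ∧ 2 ≤ H.degree w) :=
    fun x hx y hy z hz w hw h1 h2 h3 h4 h5 h6 ⟨k1, k2, k3, k4⟩ =>
      hB.false_of_degrees_3222 hunif he hx hy hz hw h1 h2 h3 h4 h5 h6 k1 k2 k3 k4
  have h332 : ∀ x ∈ e, ∀ y ∈ e, ∀ z ∈ e, x ≠ y → x ≠ z → y ≠ z →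
      ¬ (3 ≤ H.degree x ∧ 3 ≤ H.degree y ∧ 2 ≤ H.degree z) :=
    fun x hx y hy z hz h1 h2 h3 ⟨k1, k2, k3⟩ =>
      hB.false_of_degrees_332 hunif he hx hy hz h1 h2 h3 k1 k2 k3
  have key : ∀ x ∈ e, ∀ y ∈ e, ∀ z ∈ e, ∀ w ∈ e, x ≠ y → x ≠ z → x ≠ w → y ≠ z → y ≠ w → z ≠ w →
      H.edgeDegree e + 4 ≤ H.degree x + H.degree y + H.degree z + H.degree w →
      H.degree x ≤ 2 := by
    intro x hx y hy z hz w hw hxy hxz hxw hyz hyw hzw hs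
    by_contra! hx3
    have := hle x hx
    have := h322 x hx y hy z hz w hw hxy hxz hxw hyz hyw hzw
    have := h332 x hx y hy z hz hxy hxz hyz
    have := h332 x hx y hy w hw hxy hxw hyw
    have := h332 x hx z hz y hy hxz hxy hyz.symm
    have := h332 x hx z hz w hw hxz hxw hzw
    have := h332 x hx w hw y hy hxw hxy hyw.symm
    have := h332 x hx w hw z hz hxw hxz hzw.symm
    have := hle y hy
    have := hle z hz
    have := hle w hw
    omega
  have := key a ha b hb c hc d hd hab hac had hbc hbd hcd hsum
  have := key b hb a ha c hc d hd hab.symm hbc hbd hac had hcd (by omega)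
  have := key c hc a ha b hb d hd hac.symm hbc.symm hcd hab had hbd (by omega)
  have := key d hd a ha b hb c hc had.symm hbd.symm hcd.symm hab hac hbc (by omega)
  omega

end IsSubnormal

/-! ### Irreducible hypergraphs -/

/-- An edge all of whose vertices lie in further edges. -/
def IsFullEdge (H : Hypergraph α) (e : Set α) : Prop :=
  e ∈ H.edgeSet ∧ ∀ v ∈ e, 2 ≤ H.degree v

theorem IsIrreducible.edgeSet_nonempty (hirr : H.IsIrreducible) : H.edgeSet.Nonempty := by
  by_contra! h
  have hemp : IsEmpty H.edgeSet := by rw [h]; infer_instance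
  refine hirr H ⟨fun e => hemp.elim e, fun e => hemp.elim e, fun e => hemp.elim e, ?_, ?_⟩
  · rw [Set.range_eq_empty, Set.union_empty]
  · rw [Set.range_eq_empty, h]

/-- Two edges of a hypergraph with a subnormal weighting do not share three vertices. -/
theorem IsSubnormal.false_of_three_common (hB : H.IsSubnormal B) (hunif : H.IsUniform 4)
    {e f : Set α} (he : e ∈ H.edgeSet) (hf : f ∈ H.edgeSet) (hef : e ≠ f) {a b c : α}
    (hae : a ∈ e) (hbe : b ∈ e) (hce : c ∈ e) (haf : a ∈ f) (hbf : b ∈ f) (hcf : c ∈ f)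
    (hab : a ≠ b) (hac : a ≠ c) (hbc : b ≠ c) : False := by
  have h1 := hB.le_mul₃ hunif he hae hbe hce hab hac hbc
  have h2 := hB.le_mul₃ hunif hf haf hbf hcf hab hac hbc
  -- By AM-GM. Three common vertices bound the product of the two triple products by `1/64`, while
  -- it is at least `τ⁶ ≈ 0.056`.
  have key : ∀ v, v ∈ e → v ∈ f → B v e * B v f ≤ 1 / 4 := by
    intro v hve hvf
    have := hB.add_le he hve hf hvf hef
    nlinarith [sq_nonneg (B v e - B v f), hB.pos e he v hve, hB.pos f hf v hvf]
  have hp : ∀ v, v ∈ e → v ∈ f → 0 < B v e * B v f := fun v hve hvf =>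
    mul_pos (hB.pos e he v hve) (hB.pos f hf v hvf)
  have h3 := mul₃_le (hp a hae haf) (hp b hbe hbf) (hp c hce hcf) (key a hae haf) (key b hbe hbf)
    (key c hce hcf)
  have hτ := tau_lower
  have h4 : (2 * tau - 1) * (2 * tau - 1) ≤ (B a e * B b e * B c e) * (B a f * B b f * B c f) := by
    have : 0 ≤ 2 * tau - 1 := by linarith
    exact mul_le_mul h1 h2 this (this.trans h1)
  nlinarith

/-- If every edge had a vertex of degree 1, deleting one such vertex from each edge would exhibit
`H` as an extension. -/
theorem IsSubnormal.exists_isFullEdge (hB : H.IsSubnormal B) (hfin : H.vertexSet.Finite)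
    (hunif : H.IsUniform 4)
    (hirr : H.IsIrreducible) : ∃ e, H.IsFullEdge e := by
  classical
  by_contra! hcon
  have hleaf : ∀ e : Set α, ∃ v, e ∈ H.edgeSet → v ∈ e ∧ H.degree v < 2 := by
    intro e
    by_cases he : e ∈ H.edgeSet
    · have := hcon e
      unfold IsFullEdge at this
      push Not at this
      obtain ⟨v, hv, h⟩ := this he
      exact ⟨v, fun _ => ⟨hv, h⟩⟩
    · obtain ⟨f, hf⟩ := hirr.edgeSet_nonempty
      obtain ⟨a, -⟩ := hunif.exists_four hf
      exact ⟨a, fun h => absurd h he⟩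
  choose new hnew using hleaf
  have huniq : ∀ e ∈ H.edgeSet, ∀ f ∈ H.edgeSet, new e ∈ f → f = e := by
    intro e he f hf h
    by_contra hne
    have := (hnew e he).2
    have h2 : 1 < H.degree (new e) :=
      (Set.one_lt_ncard (finite_star hfin _)).2 ⟨f, ⟨hf, h⟩, e, ⟨he, (hnew e he).1⟩, hne⟩
    omega
  -- The reduced edges must stay distinct, or the extension would lose an edge; two edges with the
  -- same reduction would share three vertices.
  have hinj : Set.InjOn (fun e => e \ {new e}) H.edgeSet := by
    intro e he f hf h
    by_contra hne
    obtain ⟨a, ha, hane⟩ := hunif.exists_ne₁ he (new e)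
    obtain ⟨b, hb, hbne, hba⟩ := hunif.exists_ne₂ he (new e) a
    obtain ⟨c, hc, hcne, hca, hcb⟩ := hunif.exists_ne₃ he (new e) a b
    have hsub : ∀ v ∈ e, v ≠ new e → v ∈ f := by
      intro v hv hvne
      have : v ∈ f \ {new f} := by
        rw [← show e \ {new e} = f \ {new f} from h]; exact ⟨hv, hvne⟩
      exact this.1
    exact hB.false_of_three_common hunif he hf hne ha hb hc (hsub a ha hane) (hsub b hb hbne)
      (hsub c hc hcne) hba.symm hca.symm hcb.symm
  let H' : Hypergraph α :=
    { vertexSet := H.vertexSet \ (new '' H.edgeSet)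
      edgeSet := (fun e => e \ {new e}) '' H.edgeSet
      subset_vertexSet_of_mem_edgeSet' := by
        rintro _ ⟨e, he, rfl⟩ v ⟨hv, hvne⟩
        refine ⟨H.subset_vertexSet_of_mem_edgeSet' he hv, ?_⟩
        rintro ⟨f, hf, rfl⟩
        exact hvne (by rw [huniq f hf e he hv]; rfl) }
  have hpre : ∀ e' : H'.edgeSet, ∃ e ∈ H.edgeSet, e \ {new e} = e' := fun e' => e'.2
  choose pre hpre hpre' using hpre
  have hpre_eq : ∀ e (he : e ∈ H.edgeSet), pre ⟨e \ {new e}, e, he, rfl⟩ = e := fun e he =>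
    hinj (hpre _) he (hpre' _)
  refine hirr H' ⟨fun e' => new (pre e'), ?_, ?_, ?_, ?_⟩
  · intro e' f' h
    have h1 : pre f' = pre e' := huniq _ (hpre e') _ (hpre f') (by
      rw [show new (pre e') = new (pre f') from h]; exact (hnew _ (hpre f')).1)
    exact Subtype.ext (by rw [← hpre' e', ← hpre' f', h1])
  · exact fun e' h => h.2 ⟨_, hpre e', rfl⟩
  · ext v
    constructor
    · intro hv
      by_cases h : v ∈ new '' H.edgeSet
      · obtain ⟨e, he, rfl⟩ := h
        exact Or.inr ⟨⟨e \ {new e}, e, he, rfl⟩, by simp only [hpre_eq e he]⟩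
      · exact Or.inl ⟨hv, h⟩
    · rintro (h | ⟨e', rfl⟩)
      · exact h.1
      · exact H.subset_vertexSet_of_mem_edgeSet' (hpre e') (hnew _ (hpre e')).1
  · ext e
    have hins : ∀ f ∈ H.edgeSet, insert (new f) (f \ {new f}) = f := fun f hf =>
      Set.insert_sdiff_self_of_mem (hnew f hf).1
    constructor
    · intro he
      refine ⟨⟨e \ {new e}, e, he, rfl⟩, ?_⟩
      simp only [hpre_eq e he, hins e he]
    · rintro ⟨e', rfl⟩
      have h := hins _ (hpre e')
      rw [hpre' e'] at h
      simp only [h]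
      exact hpre e'

/-! ### Steps between flags -/

/-- A nonbacktracking step from the flag `(u, g)` to the flag `(w, g')`. -/
def Step (H : Hypergraph α) (p q : α × Set α) : Prop :=
  q.1 ∈ p.2 ∧ q.1 ≠ p.1 ∧ q.2 ∈ H.edgeSet ∧ q.1 ∈ q.2 ∧ q.2 ≠ p.2

/-- Flags reachable by nonbacktracking steps. -/
abbrev Reach (H : Hypergraph α) : α × Set α → α × Set α → Prop := Relation.ReflTransGen H.Step

/-- Being a flag. -/
def IsFlag (H : Hypergraph α) (p : α × Set α) : Prop := p.2 ∈ H.edgeSet ∧ p.1 ∈ p.2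

theorem Reach.isFlag {p q : α × Set α} (h : H.Reach p q) (hp : H.IsFlag p) : H.IsFlag q := by
  cases h with
  | refl => exact hp
  | tail _ h => exact ⟨h.2.2.1, h.2.2.2.1⟩

theorem Path.step (P : H.Path) (i : ℕ) (hi : i + 1 < P.length) :
    H.Step (P.vert ⟨i, by omega⟩, P.edge ⟨i, by omega⟩)
      (P.vert ⟨i + 1, by omega⟩, P.edge ⟨i + 1, hi⟩) := by
  refine ⟨P.right_mem ⟨i, by omega⟩, fun h => ?_, P.edge_mem _, P.left_mem ⟨i + 1, hi⟩, fun h => ?_⟩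
  · have := P.vert_injective h; simp at this
  · have := P.edge_injective h; simp at this

theorem Path.reach (P : H.Path) (i : ℕ) (hi : i < P.length) :
    H.Reach (P.vert 0, P.edge ⟨0, by omega⟩) (P.vert ⟨i, by omega⟩, P.edge ⟨i, hi⟩) := by
  induction i with
  | zero => exact .refl
  | succ i ih => exact (ih (by omega)).tail (P.step i hi)

theorem IsConnected.exists_reach_vertex (hconn : H.IsConnected) {u x : α} (hu : u ∈ H.vertexSet)
    (hx : x ∈ H.vertexSet) (hux : u ≠ x) :
    ∃ p q, H.IsFlag p ∧ p.1 = u ∧ H.Reach p q ∧ H.IsFlag q ∧ x ∈ q.2 ∧ x ≠ q.1 := by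
  obtain ⟨P, h0, h1⟩ := hconn u hu x hx
  obtain ⟨n, hn⟩ : ∃ n, P.length = n + 1 := by
    refine Nat.exists_eq_succ_of_ne_zero fun h => hux ?_
    rw [← h0, ← h1]
    congr 1
    ext
    simp [h]
  have hp : H.IsFlag (P.vert 0, P.edge ⟨0, by omega⟩) := ⟨P.edge_mem _, P.left_mem ⟨0, by omega⟩⟩
  have hr := P.reach n (by omega)
  have hlast : Fin.last P.length = (⟨n, by omega⟩ : Fin P.length).succ := by ext; simp [hn]
  refine ⟨_, _, hp, h0, hr, hr.isFlag hp, ?_, ?_⟩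
  · rw [← h1, hlast]; exact P.right_mem _
  · rw [← h1, hlast]
    intro h
    have := P.vert_injective h
    simp at this

theorem IsConnected.exists_reach_edge (hconn : H.IsConnected) (hunif : H.IsUniform 4) {u : α}
    (hu : u ∈ H.vertexSet) {e : Set α} (he : e ∈ H.edgeSet) :
    ∃ p q, H.IsFlag p ∧ p.1 = u ∧ H.Reach p q ∧ H.IsFlag q ∧ q.2 = e := by
  obtain ⟨x, hx, hxu⟩ := hunif.exists_ne₁ he u
  obtain ⟨p, q, hp, hpu, hr, hq, hxq, hxq'⟩ :=
    hconn.exists_reach_vertex hu (H.subset_vertexSet_of_mem_edgeSet' he hx) hxu.symm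
  by_cases h : q.2 = e
  · exact ⟨p, q, hp, hpu, hr, hq, h⟩
  · exact ⟨p, (x, e), hp, hpu, hr.tail ⟨hxq, hxq', he, hx, fun h' => h h'.symm⟩, ⟨he, hx⟩, rfl⟩

/-! ### Low flags -/

/-- A flag is low if its weight is at most `1 - τ = τ ^ 2`. -/
def Low (B : α → Set α → ℝ) (p : α × Set α) : Prop := B p.1 p.2 ≤ 1 - tau

namespace IsSubnormal

variable (hB : H.IsSubnormal B) (hunif : H.IsUniform 4)
include hB hunif

/-- The other two factors are at most 1, so the weight at `w` is at least `τ³/τ² = τ`. -/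
theorem tau_le_of_low {u w : α} {g : Set α} (hg : g ∈ H.edgeSet) (hu : u ∈ g) (hw : w ∈ g)
    (huw : w ≠ u) (hlow : Low B (u, g)) : tau ≤ B w g := by
  have h := hB.le_mul₂ hunif hg hu hw huw.symm
  have hw0 := hB.pos g hg w hw
  have hτ := tau_upper
  have hτ' := tau_lower
  by_contra! hlt
  have h1 : B u g * B w g ≤ (1 - tau) * B w g := mul_le_mul_of_nonneg_right hlow hw0.le
  have h2 : (1 - tau) * B w g < (1 - tau) * tau := mul_lt_mul_of_pos_left hlt (by linarith)
  have := tau_sq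
  nlinarith

/-- The weight at the exit is at least `τ`, so any other edge there gets at most `1-τ = τ²`. -/
theorem low_step {p q : α × Set α} (hp : H.IsFlag p) (hlow : Low B p) (h : H.Step p q) :
    Low B q := by
  have h1 := hB.tau_le_of_low hunif hp.1 hp.2 h.1 h.2.1 hlow
  have h2 := hB.add_le hp.1 h.1 h.2.2.1 h.2.2.2.1 h.2.2.2.2.symm
  unfold Low
  linarith

theorem low_reach {p q : α × Set α} (hp : H.IsFlag p) (hlow : Low B p) (h : H.Reach p q) :
    Low B q := by
  induction h with
  | refl => exact hlow
  | tail h1 h2 ih => exact hB.low_step hunif (Reach.isFlag h1 hp) ih h2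

/-- Two exits would bound the edge product by `τ²(1-τ³)² = 4τ⁶`, which is less than `τ³` because `τ³
< 1/4`. -/
theorem low_unique {u a b : α} {g : Set α} (hg : g ∈ H.edgeSet) (hu : u ∈ g)
    (hlow : Low B (u, g)) (ha : a ∈ g) (hau : a ≠ u) (h2a : 2 ≤ H.degree a) (hb : b ∈ g)
    (hbu : b ≠ u) (h2b : 2 ≤ H.degree b) : a = b := by
  by_contra hab
  have h := hB.le_mul₃ hunif hg hu ha hb hau.symm hbu.symm hab
  have hp := hB.pos g hg
  have h' := mul₃_le (hp u hu) (hp a ha) (hp b hb) hlow (hB.le_of_two_le_degree hunif hg ha h2a)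
    (hB.le_of_two_le_degree hunif hg hb h2b)
  have h1 : (1 - tau) * (2 - 2 * tau) * (2 - 2 * tau) = 20 - 32 * tau := by
    linear_combination (16 - 4 * tau) * tau_sq
  have := tau_lower
  linarith

theorem low_degree_le_two {u a : α} {g : Set α} (hg : g ∈ H.edgeSet) (hu : u ∈ g)
    (hlow : Low B (u, g)) (ha : a ∈ g) (hau : a ≠ u) : H.degree a ≤ 2 := by
  by_contra! h3
  have h1 := hB.le_of_three_le_degree hunif hg ha h3
  have h2 := hB.tau_le_of_low hunif hg hu ha hau hlow
  have := tau_lower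
  linarith

/-- A full edge has three exits besides `v`, and a low flag permits one. -/
theorem not_low_of_isFullEdge {e : Set α} (he : H.IsFullEdge e) {v : α} (hv : v ∈ e) :
    ¬ Low B (v, e) := by
  intro hlow
  obtain ⟨a, ha, hav⟩ := hunif.exists_ne₁ he.1 v
  obtain ⟨b, hb, hbv, hba⟩ := hunif.exists_ne₂ he.1 v a
  exact hba (hB.low_unique hunif he.1 hv hlow hb hbv (he.2 b hb) ha hav (he.2 a ha))

/-- Every vertex of a connected hypergraph with a full edge is in a flag that is not low. -/
theorem exists_not_low (hconn : H.IsConnected) {e : Set α} (he : H.IsFullEdge e) {v : α}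
    (hv : v ∈ H.vertexSet) : ∃ g ∈ H.edgeSet, v ∈ g ∧ ¬ Low B (v, g) := by
  obtain ⟨⟨p1, p2⟩, ⟨q1, q2⟩, hp, rfl, hr, hq, rfl⟩ := hconn.exists_reach_edge hunif hv he.1
  exact ⟨p2, hp.1, hp.2, fun hlow => hB.not_low_of_isFullEdge hunif he hq.2
    (hB.low_reach hunif hp hlow hr)⟩

/-- Three edges besides the one whose flag is not low would leave that flag at most `1-3τ³ ≈ 0.29`,
below `τ²`. -/
theorem degree_le_three (hconn : H.IsConnected) {e : Set α} (he : H.IsFullEdge e) {v : α}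
    (hv : v ∈ H.vertexSet) : H.degree v ≤ 3 := by
  by_contra! h4
  obtain ⟨g, hg, hvg, hlow⟩ := hB.exists_not_low hunif hconn he hv
  obtain ⟨a, ha, hva, hag⟩ := exists_edge_ne (by omega : 2 ≤ H.degree v) g
  obtain ⟨b, hb, hvb, hbg, hba⟩ := exists_edge_ne₂ (by omega : 3 ≤ H.degree v) g a
  obtain ⟨c, hc, hvc, hcg, hca, hcb⟩ := exists_edge_ne₃ (by omega : 4 ≤ H.degree v) g a b
  have := hB.add_add_add_le hg hvg ha hva hb hvb hc hvc hag.symm hbg.symm hcg.symm hba.symm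
    hca.symm hcb.symm
  have := hB.le_apply hunif ha hva
  have := hB.le_apply hunif hb hvb
  have := hB.le_apply hunif hc hvc
  have := tau_lower
  refine hlow ?_
  unfold Low
  linarith

end IsSubnormal

/-! ### Acyclicity -/

namespace IsSubnormal

variable (hB : H.IsSubnormal B) (hunif : H.IsUniform 4)
include hB hunif

/-- A cycle from which only low flags branch off does not lead to a full edge outside it. -/
theorem false_of_cycle_closed (hconn : H.IsConnected) {e₀ : Set α}
    (he₀ : H.IsFullEdge e₀) {n : ℕ} {v : Fin (n + 2) → α} {e : Fin (n + 2) → Set α}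
    (hc : ∀ i, e i ∈ H.edgeSet ∧ v i ∈ e i ∧ v (i + 1) ∈ e i)
    (h1 : ∀ i, ∀ f ∈ H.edgeSet, v i ∈ f → f ∈ Set.range e)
    (h2 : ∀ i, ∀ w ∈ e i, w ∉ Set.range v → ∀ f ∈ H.edgeSet, w ∈ f → f ≠ e i → Low B (w, f))
    (h3 : ∀ i, e i ≠ e₀) : False := by
  have hv : v 0 ∈ H.vertexSet := H.subset_vertexSet_of_mem_edgeSet' (hc 0).1 (hc 0).2.1
  obtain ⟨p, q, hp, hp0, hr, hq, hqe⟩ := hconn.exists_reach_edge hunif hv he₀.1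
  have key : q.2 ∈ Set.range e ∨ Low B q := by
    clear hqe hq
    induction hr with
    | refl => exact Or.inl (h1 0 _ hp.1 (hp0 ▸ hp.2))
    | @tail q r hr hs ih =>
      rcases ih with ⟨i, hi⟩ | hlow
      · by_cases hw : r.1 ∈ Set.range v
        · obtain ⟨j, hj⟩ := hw
          exact Or.inl (h1 j _ hs.2.2.1 (hj ▸ hs.2.2.2.1))
        · exact Or.inr (h2 i r.1 (hi ▸ hs.1) hw r.2 hs.2.2.1 hs.2.2.2.1 (hi ▸ hs.2.2.2.2))
      · exact Or.inr (hB.low_step hunif (Reach.isFlag hr hp) hlow hs)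
  rcases key with ⟨i, hi⟩ | hlow
  · exact h3 i (hi.trans hqe)
  · refine hB.not_low_of_isFullEdge hunif he₀ (v := q.1) (hqe ▸ hq.2) ?_
    rw [← hqe]; exact hlow

/-- One low flag makes all flags in that orientation of the cycle low. The unique exit of each edge
is then the next cycle vertex, so the cycle is all of the component, yet it contains no full edge.
-/
theorem false_of_cycle_low (hfin : H.vertexSet.Finite) (hconn : H.IsConnected) {e₀ : Set α}
    (he₀ : H.IsFullEdge e₀) {n : ℕ} {v : Fin (n + 2) → α} {e : Fin (n + 2) → Set α}
    (hv : Function.Injective v) (he : Function.Injective e)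
    (hc : ∀ i, e i ∈ H.edgeSet ∧ v i ∈ e i ∧ v (i + 1) ∈ e i) {i₀ : Fin (n + 2)}
    (hi₀ : Low B (v i₀, e i₀)) : False := by
  have hne : ∀ i : Fin (n + 2), i + 1 ≠ i := fun i => by simp
  have hlow : ∀ i, Low B (v i, e i) := by
    have : ∀ k, Low B (v (i₀ + k), e (i₀ + k)) := by
      intro k
      induction k using Fin.induction with
      | zero => simpa using hi₀
      | succ k ih =>
        rw [← Fin.coeSucc_eq_succ, ← add_assoc]
        exact hB.low_step hunif ⟨(hc _).1, (hc _).2.1⟩ ih ⟨(hc _).2.2, fun h => hne _ (hv h),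
          (hc _).1, (hc _).2.1, fun h => hne _ (he h)⟩
    intro i
    simpa using this (i - i₀)
  have hdeg : ∀ i, 2 ≤ H.degree (v (i + 1)) := fun i =>
    two_le_degree hfin (hc i).1 (hc i).2.2 (hc (i + 1)).1 (hc (i + 1)).2.1
      fun h => hne i (he h.symm)
  refine hB.false_of_cycle_closed hunif hconn he₀ hc ?_ ?_ ?_
  · intro j f hf hvf
    obtain ⟨i, rfl⟩ : ∃ i, i + 1 = j := ⟨j - 1, sub_add_cancel _ _⟩
    have h2 := hB.low_degree_le_two hunif (hc i).1 (hc i).2.1 (hlow i) (hc i).2.2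
      fun h => hne i (hv h)
    by_contra hcon
    have := three_le_degree hfin (hc i).1 (hc i).2.2 (hc (i + 1)).1 (hc (i + 1)).2.1 hf hvf
      (fun h => hne i (he h.symm)) (fun h => hcon ⟨_, h⟩) (fun h => hcon ⟨_, h⟩)
    omega
  · intro i w hw hwv f hf hwf hfe
    exfalso
    refine hwv ⟨i + 1, ?_⟩
    exact hB.low_unique hunif (hc i).1 (hc i).2.1 (hlow i) (hc i).2.2 (fun h => hne i (hv h))
      (hdeg i) hw (fun h => hwv ⟨i, h.symm⟩) (two_le_degree hfin hf hwf (hc i).1 hw hfe)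
  · intro i h
    exact hB.not_low_of_isFullEdge hunif (h ▸ he₀) (hc i).2.1 (hlow i)

/-- With no low flag in either orientation, all weights along the cycle lie strictly between `τ²`
and `τ`. No third edge fits at a cycle vertex, as `2τ²+τ³ = 1`; a cycle edge has weight at least `τ`
at its other vertices, so everything branching off is low; and no cycle edge is full. -/
theorem not_hasCycle (hfin : H.vertexSet.Finite) (hconn : H.IsConnected) {e₀ : Set α}
    (he₀ : H.IsFullEdge e₀) : ¬ H.HasCycle := by
  rintro ⟨n, v, e, hv, he, hc⟩
  have hne : ∀ i : Fin (n + 2), i + 1 ≠ i := fun i => by simp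
  have hA : ∀ i, 1 - tau < B (v i) (e i) := by
    intro i
    by_contra! h
    exact hB.false_of_cycle_low hunif hfin hconn he₀ hv he hc h
  have hA' : ∀ i, 1 - tau < B (v (i + 1)) (e i) := by
    intro i
    by_contra! h
    -- The same cycle traversed backwards: the edge joining `v (-j)` to `v (-j-1)` is `e (-j-1)`.
    refine hB.false_of_cycle_low hunif hfin hconn he₀ (v := fun j => v (-j))
      (e := fun j => e (-j - 1)) (hv.comp neg_injective)
      (fun a b hab => neg_injective (sub_left_injective (he hab))) (fun j => ?_)
      (i₀ := -(i + 1)) (by simpa [Low] using h)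
    refine ⟨(hc _).1, ?_, ?_⟩
    · have := (hc (-j - 1)).2.2
      rwa [sub_add_cancel] at this
    · have := (hc (-j - 1)).2.1
      simpa only [neg_add'] using this
  have hτ := tau_lower
  have hτ' := tau_upper
  have hlt : ∀ i, B (v (i + 1)) (e i) < tau := by
    intro i
    have := hB.add_le (hc i).1 (hc i).2.2 (hc (i + 1)).1 (hc (i + 1)).2.1 fun h => hne i (he h.symm)
    have := hA (i + 1)
    linarith
  have hlt' : ∀ i, B (v i) (e i) < tau := by
    intro j
    obtain ⟨i, rfl⟩ : ∃ i, i + 1 = j := ⟨j - 1, sub_add_cancel _ _⟩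
    have := hB.add_le (hc i).1 (hc i).2.2 (hc (i + 1)).1 (hc (i + 1)).2.1 fun h => hne i (he h.symm)
    have := hA' i
    linarith
  have h3 : ∀ i, e i ≠ e₀ := by
    intro i h
    have hfull : H.IsFullEdge (e i) := h ▸ he₀
    have hvv : v i ≠ v (i + 1) := fun h => hne i (hv h).symm
    obtain ⟨a, ha, hav, hav'⟩ := hunif.exists_ne₂ hfull.1 (v i) (v (i + 1))
    obtain ⟨b, hb, hbv, hbv', hba⟩ := hunif.exists_ne₃ hfull.1 (v i) (v (i + 1)) a
    have h := hB.le_mul₄ hunif hfull.1 (hc i).2.1 (hc i).2.2 ha hb hvv hav.symm hbv.symm hav'.symm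
      hbv'.symm hba.symm
    have hp := hB.pos _ hfull.1
    have h' := mul₄_le (hp _ (hc i).2.1) (hp _ (hc i).2.2) (hp _ ha) (hp _ hb) (hlt' i).le (hlt i).le
      (hB.le_of_two_le_degree hunif hfull.1 ha (hfull.2 a ha))
      (hB.le_of_two_le_degree hunif hfull.1 hb (hfull.2 b hb))
    have h1 : tau * tau * (2 - 2 * tau) * (2 - 2 * tau) = 20 - 32 * tau := by
      linear_combination (4 * tau ^ 2 - 12 * tau + 20) * tau_sq
    linarith
  refine hB.false_of_cycle_closed hunif hconn he₀ hc ?_ ?_ h3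
  · intro j f hf hvf
    obtain ⟨i, rfl⟩ : ∃ i, i + 1 = j := ⟨j - 1, sub_add_cancel _ _⟩
    by_contra hcon
    have := hB.add_add_le (hc i).1 (hc i).2.2 (hc (i + 1)).1 (hc (i + 1)).2.1 hf hvf
      (fun h => hne i (he h.symm)) (fun h => hcon ⟨_, h⟩) (fun h => hcon ⟨_, h⟩)
    have := hB.le_apply hunif hf hvf
    have := hA' i
    have := hA (i + 1)
    linarith
  · intro i w hw hwv f hf hwf hfe
    have hwi : w ≠ v i := fun h => hwv ⟨_, h.symm⟩
    have hwi' : w ≠ v (i + 1) := fun h => hwv ⟨_, h.symm⟩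
    have h := hB.le_mul₃ hunif (hc i).1 (hc i).2.1 (hc i).2.2 hw (fun h => hne i (hv h).symm)
      hwi.symm hwi'.symm
    have hp := hB.pos _ (hc i).1
    have h' := mul₃_le (hp _ (hc i).2.1) (hp _ (hc i).2.2) (hp w hw) (hlt' i).le (hlt i).le le_rfl
    have h4 := hB.add_le (hc i).1 hw hf hwf hfe.symm
    have h5 := tau_pow_three
    have h6 : tau ≤ B w (e i) := by
      by_contra! hcon
      have : tau * tau * B w (e i) < tau * tau * tau := by gcongr
      nlinarith
    unfold Low
    linarith

end IsSubnormal

/-! ### Walks in acyclic hypergraphs -/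

theorem hasCycle_of_seq {d : ℕ} (hd : 2 ≤ d) {u : ℕ → α} {g : ℕ → Set α}
    (hu : ∀ i < d, ∀ j < d, u i = u j → i = j) (hg : ∀ i < d, ∀ j < d, g i = g j → i = j)
    (hmem : ∀ i < d, g i ∈ H.edgeSet ∧ u i ∈ g i) (hnext : ∀ i, i + 1 < d → u (i + 1) ∈ g i)
    (hlast : u 0 ∈ g (d - 1)) : H.HasCycle := by
  obtain ⟨n, rfl⟩ : ∃ n, d = n + 2 := ⟨d - 2, by omega⟩
  refine ⟨n, fun i => u i, fun i => g i, fun i j h => Fin.ext (hu _ i.2 _ j.2 h),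
    fun i j h => Fin.ext (hg _ i.2 _ j.2 h), fun i => ⟨(hmem i i.2).1, (hmem i i.2).2, ?_⟩⟩
  change u ((i + 1 : Fin (n + 2)) : ℕ) ∈ g i
  rw [Fin.val_add_one]
  split_ifs with h
  · subst h; simpa using hlast
  · refine hnext i ?_
    have : (i : ℕ) ≠ n + 1 := fun h' => h (Fin.ext (by simpa using h'))
    omega

/-- A nonbacktracking sequence in an acyclic hypergraph repeats neither vertices nor edges. -/
theorem injOn_of_nonbacktracking (hac : ¬ H.HasCycle) {N : ℕ} {u : ℕ → α} {g : ℕ → Set α}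
    (hmem : ∀ i < N, g i ∈ H.edgeSet ∧ u i ∈ g i ∧ u (i + 1) ∈ g i)
    (hu : ∀ i < N, u (i + 1) ≠ u i) (hg : ∀ i, i + 1 < N → g (i + 1) ≠ g i) (d : ℕ) :
    (∀ i, i + (d + 1) ≤ N → u (i + (d + 1)) ≠ u i) ∧
      ∀ i, i + (d + 1) < N → g (i + (d + 1)) ≠ g i := by
  induction d using Nat.strong_induction_on with
  | _ d ih =>
    have hu' : ∀ i j, i < j → j ≤ N → j - i ≤ d → u j ≠ u i := by
      intro i j hij hj hd
      have := (ih (j - i - 1) (by omega)).1 i (by omega)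
      rwa [show i + (j - i - 1 + 1) = j by omega] at this
    have hg' : ∀ i j, i < j → j < N → j - i ≤ d → g j ≠ g i := by
      intro i j hij hj hd
      have := (ih (j - i - 1) (by omega)).2 i (by omega)
      rwa [show i + (j - i - 1 + 1) = j by omega] at this
    have hinju : ∀ k, k + (d + 1) ≤ N + 1 → ∀ i < d + 1, ∀ j < d + 1, u (k + i) = u (k + j) → i = j := by
      intro k hk i hi j hj h
      rcases lt_trichotomy i j with hij | hij | hij
      · exact absurd h.symm (hu' _ _ (by omega) (by omega) (by omega))
      · exact hij
      · exact absurd h (hu' _ _ (by omega) (by omega) (by omega))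
    have hinjg : ∀ k, k + (d + 1) ≤ N → ∀ i < d + 1, ∀ j < d + 1, g (k + i) = g (k + j) → i = j := by
      intro k hk i hi j hj h
      rcases lt_trichotomy i j with hij | hij | hij
      · exact absurd h.symm (hg' _ _ (by omega) (by omega) (by omega))
      · exact hij
      · exact absurd h (hg' _ _ (by omega) (by omega) (by omega))
    -- A gap of 1 is excluded by hypothesis. For larger gaps, a first repetition closes a cycle of
    -- length `d+1`: a repeated vertex directly, a repeated edge `g k` after starting from the
    -- vertex `k+1`.
    rcases Nat.eq_zero_or_pos d with rfl | hd
    · exact ⟨fun i hi => hu i (by omega), fun i hi => hg i hi⟩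
    refine ⟨fun k hk h => hac ?_, fun k hk h => hac ?_⟩
    · refine hasCycle_of_seq (d := d + 1) (by omega) (u := fun i => u (k + i))
        (g := fun i => g (k + i)) (hinju k (by omega)) (hinjg k hk)
        (fun i hi => ⟨(hmem _ (by omega)).1, (hmem _ (by omega)).2.1⟩)
        (fun i hi => (hmem (k + i) (by omega)).2.2) ?_
      have := (hmem (k + d) (by omega)).2.2
      rw [add_assoc, h] at this
      exact this
    · refine hasCycle_of_seq (d := d + 1) (by omega) (u := fun i => u (k + 1 + i))
        (g := fun i => g (k + 1 + i)) (hinju (k + 1) (by omega)) (hinjg (k + 1) (by omega))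
        (fun i hi => ⟨(hmem _ (by omega)).1, (hmem _ (by omega)).2.1⟩)
        (fun i hi => (hmem (k + 1 + i) (by omega)).2.2) ?_
      have := (hmem k (by omega)).2.2
      simp only [Nat.add_sub_cancel]
      rw [show k + 1 + d = k + (d + 1) by omega, h]
      exact this

/-- A sequence of flags joined by steps. -/
def IsFlagWalk (H : Hypergraph α) (F : ℕ → α × Set α) (M : ℕ) : Prop :=
  H.IsFlag (F 0) ∧ ∀ i < M, H.Step (F i) (F (i + 1))

theorem IsFlagWalk.isFlag {F : ℕ → α × Set α} {M : ℕ} (hF : H.IsFlagWalk F M) {i : ℕ}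
    (hi : i ≤ M) : H.IsFlag (F i) := by
  cases i with
  | zero => exact hF.1
  | succ i => exact ⟨(hF.2 i hi).2.2.1, (hF.2 i hi).2.2.2.1⟩

theorem IsFlagWalk.exists_path (hac : ¬ H.HasCycle) {F : ℕ → α × Set α} {M : ℕ}
    (hF : H.IsFlagWalk F M) {z : α} (hz : z ∈ (F M).2) (hz' : z ≠ (F M).1) :
    ∃ P : H.Path, P.length = M + 1 ∧ (∀ i : Fin P.length, P.vert i.castSucc = (F i).1) ∧
      (∀ i : Fin P.length, P.edge i = (F i).2) ∧ P.vert (Fin.last _) = z := by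
  let u : ℕ → α := fun i => if i ≤ M then (F i).1 else z
  have hu : ∀ i ≤ M, u i = (F i).1 := fun i hi => if_pos hi
  have huM : u (M + 1) = z := if_neg (by omega)
  have hmem : ∀ i < M + 1, (F i).2 ∈ H.edgeSet ∧ u i ∈ (F i).2 ∧ u (i + 1) ∈ (F i).2 := by
    intro i hi
    have := hF.isFlag (i := i) (by omega)
    refine ⟨this.1, hu i (by omega) ▸ this.2, ?_⟩
    rcases (by omega : i < M ∨ i = M) with h | rfl
    · rw [hu _ (by omega)]; exact (hF.2 i h).1
    · rw [huM]; exact hz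
  have hne : ∀ i < M + 1, u (i + 1) ≠ u i := by
    intro i hi
    rw [hu i (by omega)]
    rcases (by omega : i < M ∨ i = M) with h | rfl
    · rw [hu _ (by omega)]; exact (hF.2 i h).2.1
    · rw [huM]; exact hz'
  have hinj := injOn_of_nonbacktracking hac hmem hne (g := fun i => (F i).2)
    fun i hi => (hF.2 i (by omega)).2.2.2.2
  refine ⟨{ length := M + 1, vert := fun i => u i, edge := fun i => (F i).2
            vert_mem := fun i => ?_, edge_mem := fun i => (hmem i i.2).1
            left_mem := fun i => (hmem i i.2).2.1, right_mem := fun i => (hmem i i.2).2.2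
            vert_injective := fun i j h => ?_, edge_injective := fun i j h => ?_ },
    rfl, fun i => hu i (by have : (i : ℕ) < M + 1 := i.2; omega), fun i => rfl, huM⟩
  · rcases (by have := i.2; omega : (i : ℕ) < M + 1 ∨ (i : ℕ) = M + 1) with h | h
    · exact H.subset_vertexSet_of_mem_edgeSet' (hmem i h).1 (hmem i h).2.1
    · rw [h]
      exact H.subset_vertexSet_of_mem_edgeSet' (hmem M (by omega)).1 (hmem M (by omega)).2.2
  · have hi := i.2
    have hj := j.2
    refine Fin.ext ?_
    rcases lt_trichotomy (i : ℕ) j with hij | hij | hij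
    · have := (hinj (j - i - 1)).1 i (by omega)
      rw [show (i : ℕ) + (j - i - 1 + 1) = j by omega] at this
      exact absurd h.symm this
    · exact hij
    · have := (hinj (i - j - 1)).1 j (by omega)
      rw [show (j : ℕ) + (i - j - 1 + 1) = i by omega] at this
      exact absurd h this
  · have hi := i.2
    have hj := j.2
    refine Fin.ext ?_
    rcases lt_trichotomy (i : ℕ) j with hij | hij | hij
    · have := (hinj (j - i - 1)).2 i (by omega)
      rw [show (i : ℕ) + (j - i - 1 + 1) = j by omega] at this
      exact absurd h.symm this
    · exact hij
    · have := (hinj (i - j - 1)).2 j (by omega)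
      rw [show (j : ℕ) + (i - j - 1 + 1) = i by omega] at this
      exact absurd h this

theorem IsFlagWalk.lt_ncard (hfin : H.vertexSet.Finite) (hunif : H.IsUniform 4)
    (hac : ¬ H.HasCycle) {F : ℕ → α × Set α} {M : ℕ} (hF : H.IsFlagWalk F M) :
    M < H.edgeSet.ncard := by
  obtain ⟨z, hz, hz'⟩ := hunif.exists_ne₁ (hF.isFlag le_rfl).1 (F M).1
  obtain ⟨P, hP, -⟩ := hF.exists_path hac hz hz'
  have : Finite H.edgeSet := finite_edgeSet hfin
  have h := Nat.card_le_card_of_injective (fun i : Fin P.length => (⟨P.edge i, P.edge_mem i⟩ : H.edgeSet))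
    fun i j hij => P.edge_injective (congrArg Subtype.val hij)
  rw [Nat.card_fin, Nat.card_coe_set_eq, hP] at h
  omega

/-- In a finite acyclic hypergraph every flag starts a walk through flags satisfying `Q` that
cannot be prolonged. -/
theorem exists_maximal_flagWalk (hfin : H.vertexSet.Finite) (hunif : H.IsUniform 4)
    (hac : ¬ H.HasCycle) (Q : α × Set α → Prop) {p : α × Set α} (hp : H.IsFlag p) :
    ∃ F M, H.IsFlagWalk F M ∧ F 0 = p ∧ (∀ i < M, Q (F (i + 1))) ∧
      ∀ q, Q q → ¬ H.Step (F M) q := by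
  by_contra! hcon
  have : ∀ M, ∃ F, H.IsFlagWalk F M ∧ F 0 = p ∧ ∀ i < M, Q (F (i + 1)) := by
    intro M
    induction M with
    | zero => exact ⟨fun _ => p, ⟨hp, by simp⟩, rfl, by simp⟩
    | succ M ih =>
      obtain ⟨F, hF, h0, hQ⟩ := ih
      obtain ⟨q, hq, hs⟩ := hcon F M hF h0 hQ
      have hle : ∀ i ≤ M, (fun i => if i ≤ M then F i else q) i = F i := fun i hi => if_pos hi
      have hM : (fun i => if i ≤ M then F i else q) (M + 1) = q := if_neg (by omega)
      refine ⟨fun i => if i ≤ M then F i else q, ⟨?_, fun i hi => ?_⟩, ?_, fun i hi => ?_⟩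
      · rw [hle 0 (by omega)]; exact hF.1
      · rw [hle i (by omega)]
        rcases (by omega : i < M ∨ i = M) with h | rfl
        · rw [hle _ (by omega)]; exact hF.2 i h
        · rw [hM]; exact hs
      · rw [hle 0 (by omega), h0]
      · rcases (by omega : i < M ∨ i = M) with h | rfl
        · rw [hle _ (by omega)]; exact hQ i h
        · rw [hM]; exact hq
  obtain ⟨F, hF, -⟩ := this H.edgeSet.ncard
  exact lt_irrefl _ (hF.lt_ncard hfin hunif hac)

/-! ### Branching edges -/

theorem IsBranchingEdge.degree_le_two {k : ℕ} {e : Set α} (he : H.IsBranchingEdge k e) {v : α}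
    (hv : v ∈ e) : H.degree v ≤ 2 := by
  by_contra! h
  exact he.2.2.1 v hv _ ⟨H.subset_vertexSet_of_mem_edgeSet' he.1 hv, h, rfl⟩

theorem IsBranchingEdge.exists_three (hfin : H.vertexSet.Finite) (hunif : H.IsUniform 4) {k : ℕ}
    {e : Set α} (he : H.IsBranchingEdge k e) :
    ∃ a b c, a ∈ e ∧ b ∈ e ∧ c ∈ e ∧ a ≠ b ∧ a ≠ c ∧ b ≠ c ∧ 2 ≤ H.degree a ∧ 2 ≤ H.degree b ∧
      2 ≤ H.degree c := by
  obtain ⟨a, b, c, d, ha, hb, hc, hd, hab, hac, had, hbc, hbd, hcd⟩ := hunif.exists_four he.1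
  have heq := hunif.eq_of_mem he.1 ha hb hc hd hab hac had hbc hbd hcd
  have hsum := edgeDegree_add_four_le hfin (heq ▸ he.1)
  rw [← heq] at hsum
  have h2a := he.degree_le_two ha
  have h2b := he.degree_le_two hb
  have h2c := he.degree_le_two hc
  have h2d := he.degree_le_two hd
  have h3 := he.2.1
  have hk := he.2.2.2
  by_cases hda : 2 ≤ H.degree a
  · by_cases hdb : 2 ≤ H.degree b
    · by_cases hdc : 2 ≤ H.degree c
      · exact ⟨a, b, c, ha, hb, hc, hab, hac, hbc, hda, hdb, hdc⟩
      · exact ⟨a, b, d, ha, hb, hd, hab, had, hbd, hda, hdb, by omega⟩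
    · exact ⟨a, c, d, ha, hc, hd, hac, had, hcd, hda, by omega, by omega⟩
  · exact ⟨b, c, d, hb, hc, hd, hbc, hbd, hcd, by omega, by omega, by omega⟩

theorem IsBranchingEdge.isFullEdge (hfin : H.vertexSet.Finite) (hunif : H.IsUniform 4)
    {e : Set α} (he : H.IsBranchingEdge 4 e) : H.IsFullEdge e := by
  refine ⟨he.1, fun v hv => ?_⟩
  obtain ⟨a, ha, hav⟩ := hunif.exists_ne₁ he.1 v
  obtain ⟨b, hb, hbv, hba⟩ := hunif.exists_ne₂ he.1 v a
  obtain ⟨c, hc, hcv, hca, hcb⟩ := hunif.exists_ne₃ he.1 v a b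
  have heq := hunif.eq_of_mem he.1 hv ha hb hc hav.symm hbv.symm hcv.symm hba.symm hca.symm hcb.symm
  have hsum := edgeDegree_add_four_le hfin (heq ▸ he.1)
  rw [← heq] at hsum
  have h2a := he.degree_le_two ha
  have h2b := he.degree_le_two hb
  have h2c := he.degree_le_two hc
  have hk := he.2.2.2
  omega

theorem IsBranchingEdge.degree_eq_two (hfin : H.vertexSet.Finite) (hunif : H.IsUniform 4)
    {e : Set α} (he : H.IsBranchingEdge 4 e) {v : α} (hv : v ∈ e) : H.degree v = 2 :=
  le_antisymm (he.degree_le_two hv) ((he.isFullEdge hfin hunif).2 v hv)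

/-! ### Local restrictions on flags that are not low -/

namespace IsSubnormal

variable (hB : H.IsSubnormal B)
include hB

theorem lt_tau_of_not_low {v : α} {e f : Set α} (he : e ∈ H.edgeSet) (hve : v ∈ e)
    (hf : f ∈ H.edgeSet) (hvf : v ∈ f) (hef : f ≠ e) (hlow : ¬ Low B (v, f)) : B v e < tau := by
  have := hB.add_le he hve hf hvf hef.symm
  unfold Low at hlow
  push Not at hlow
  linarith

/-- The product would be below `τ·τ·τ·1`. -/
theorem false_of_lt_tau₃ (hunif : H.IsUniform 4) {e : Set α} (he : e ∈ H.edgeSet) {a b c : α}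
    (ha : a ∈ e) (hb : b ∈ e) (hc : c ∈ e) (hab : a ≠ b) (hac : a ≠ c) (hbc : b ≠ c)
    (hta : B a e < tau) (htb : B b e < tau) (htc : B c e < tau) : False := by
  have h := hB.le_mul₃ hunif he ha hb hc hab hac hbc
  have hp := hB.pos e he
  have h1 := mul₃_le (hp a ha) (hp b hb) (hp c hc) le_rfl htb.le htc.le
  have h2 := tau_lower
  have h3 : B a e * tau * tau < tau * tau * tau := by gcongr
  have := tau_pow_three
  nlinarith

/-- Fullness bounds the remaining two weights by `1-τ³ = 2τ²`, so the product is at most `4τ⁶ < τ³`.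
-/
theorem false_of_lt_tau₂_full (hunif : H.IsUniform 4) {e : Set α} (he : H.IsFullEdge e) {a b : α}
    (ha : a ∈ e) (hb : b ∈ e) (hab : a ≠ b) (hta : B a e < tau) (htb : B b e < tau) : False := by
  obtain ⟨c, hc, hca, hcb⟩ := hunif.exists_ne₂ he.1 a b
  obtain ⟨d, hd, hda, hdb, hdc⟩ := hunif.exists_ne₃ he.1 a b c
  have h := hB.le_mul₄ hunif he.1 ha hb hc hd hab hca.symm hda.symm hcb.symm hdb.symm hdc.symm
  have hp := hB.pos e he.1
  have h' := mul₄_le (hp a ha) (hp b hb) (hp c hc) (hp d hd) hta.le htb.le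
    (hB.le_of_two_le_degree hunif he.1 hc (he.2 c hc))
    (hB.le_of_two_le_degree hunif he.1 hd (he.2 d hd))
  have h1 : tau * tau * (2 - 2 * tau) * (2 - 2 * tau) = 20 - 32 * tau := by
    linear_combination (4 * tau ^ 2 - 12 * tau + 20) * tau_sq
  have := tau_lower
  linarith

/-- A third edge brings the sum above `2τ²+τ³ = 1`. -/
theorem false_of_not_low₂ (hunif : H.IsUniform 4) {v : α} (h3 : 3 ≤ H.degree v) {e f : Set α}
    (he : e ∈ H.edgeSet) (hve : v ∈ e) (hf : f ∈ H.edgeSet) (hvf : v ∈ f) (hef : e ≠ f)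
    (hle : ¬ Low B (v, e)) (hlf : ¬ Low B (v, f)) : False := by
  obtain ⟨g, hg, hvg, hge, hgf⟩ := exists_edge_ne₂ h3 e f
  have := hB.add_add_le he hve hf hvf hg hvg hef hge.symm hgf.symm
  have := hB.le_apply hunif hg hvg
  unfold Low at hle hlf
  push Not at hle hlf
  linarith

theorem not_isBranchingEdge_of_low (hfin : H.vertexSet.Finite) (hunif : H.IsUniform 4) {u : α}
    {g : Set α} (hu : u ∈ g) (hlow : Low B (u, g)) (k : ℕ) : ¬ H.IsBranchingEdge k g := by
  intro hg
  obtain ⟨a, b, c, ha, hb, hc, hab, hac, hbc, h2a, h2b, h2c⟩ := hg.exists_three hfin hunif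
  by_cases hau : a = u
  · exact hbc (hB.low_unique hunif hg.1 hu hlow hb (hau ▸ hab.symm) h2b hc (hau ▸ hac.symm) h2c)
  · by_cases hbu : b = u
    · exact hac (hB.low_unique hunif hg.1 hu hlow ha hau h2a hc (hbu ▸ hbc.symm) h2c)
    · exact hab (hB.low_unique hunif hg.1 hu hlow ha hau h2a hb hbu h2b)

end IsSubnormal

/-! ### Attached paths -/

theorem IsFlagWalk.low (hB : H.IsSubnormal B) (hunif : H.IsUniform 4) {F : ℕ → α × Set α} {M : ℕ}
    (hF : H.IsFlagWalk F M) (h0 : Low B (F 0)) {i : ℕ} (hi : i ≤ M) : Low B (F i) := by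
  induction i with
  | zero => exact h0
  | succ i ih =>
    exact hB.low_step hunif (hF.isFlag (by omega)) (ih (by omega)) (hF.2 i (by omega))

/-- A maximal walk starting at the low flag stays low, so each of its edges has no exit other than
the next vertex, and the last edge has none at all. -/
theorem IsSubnormal.exists_hasAttachedPath (hB : H.IsSubnormal B) (hfin : H.vertexSet.Finite)
    (hunif : H.IsUniform 4) (hac : ¬ H.HasCycle) {e g : Set α} (he : H.IsFullEdge e) {u : α}
    (hue : u ∈ e) (h2 : H.degree u = 2) (hg : g ∈ H.edgeSet) (hug : u ∈ g)
    (hlow : Low B (u, g)) : ∃ m, H.HasAttachedPath e u m := by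
  obtain ⟨F, M, hF, h0, -, hmax⟩ := exists_maximal_flagWalk hfin hunif hac (fun _ => True)
    (p := (u, g)) ⟨hg, hug⟩
  have hlowF : ∀ i ≤ M, Low B (F i) := fun i hi => hF.low hB hunif (h0 ▸ hlow) hi
  obtain ⟨z, hz, hz'⟩ := hunif.exists_ne₁ (hF.isFlag le_rfl).1 (F M).1
  obtain ⟨P, hP, hvert, hedge, -⟩ := hF.exists_path hac hz hz'
  have hle : ∀ i : Fin P.length, (i : ℕ) ≤ M := fun i => by have := i.2; omega
  refine ⟨M + 1, he.1, hue, by omega, P, hP, ?_, fun i h => ?_, fun i => ?_, fun i w hw hne => ?_⟩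
  · have := hvert ⟨0, by omega⟩
    rw [show (0 : Fin (P.length + 1)) = Fin.castSucc ⟨0, by omega⟩ from rfl, this]
    simp [h0]
  · rw [hedge] at h
    refine hB.not_low_of_isFullEdge hunif he (v := (F i).1)
      (h ▸ (hF.isFlag (hle i)).2) ?_
    rw [← h]; exact hlowF i (hle i)
  · rw [hvert]
    rcases Nat.eq_zero_or_pos (i : ℕ) with h | h
    · rw [h, h0]; exact h2
    · obtain ⟨j, hj⟩ := Nat.exists_eq_succ_of_ne_zero h.ne'
      have hjM : j < M := by have := hle i; omega
      rw [hj]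
      have hs := hF.2 j hjM
      have hfl := hF.isFlag hjM.le
      refine le_antisymm ?_ ?_
      · exact hB.low_degree_le_two hunif hfl.1 hfl.2 (hlowF j hjM.le) hs.1 hs.2.1
      · exact two_le_degree hfin hs.2.2.1 hs.2.2.2.1 hfl.1 hs.1 hs.2.2.2.2
  · have hw' := hw
    rw [hedge] at hw
    have hfl := hF.isFlag (hle i)
    have hwi : w ≠ (F i).1 := hvert i ▸ hne i
    by_contra h1
    have hw2 : 2 ≤ H.degree w := by
      have := one_le_degree hfin hfl.1 hw
      omega
    obtain ⟨f, hf, hwf, hfi⟩ := exists_edge_ne hw2 (F i).2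
    rcases (hle i).lt_or_eq with hi | hi
    · have hs := hF.2 i hi
      refine hne ⟨i + 1, by omega⟩ ?_
      rw [hvert]
      exact hB.low_unique hunif hfl.1 hfl.2 (hlowF i hi.le) hw hwi hw2 hs.1 hs.2.1
        (two_le_degree hfin hs.2.2.1 hs.2.2.2.1 hfl.1 hs.1 hs.2.2.2.2)
    · exact hmax (w, f) trivial (by rw [← hi]; exact ⟨hw, hwi, hf, hwf, hfi⟩)

/-! ### Lengths of attached paths -/

/-- A lower bound for the weight of the first flag of a path with `k` edges. -/
noncomputable def pathWeight : ℕ → ℝ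
  | 0 => 0
  | k + 1 => (2 * tau - 1) / (1 - pathWeight k)

/-- Induction from the far end: the next flag's weight caps the present edge at the common vertex,
and the edge product then bounds the weight at the near vertex from below. The `k + 1` counts edge
`i` itself. -/
theorem IsSubnormal.pathWeight_le (hB : H.IsSubnormal B) (hunif : H.IsUniform 4) (P : H.Path)
    (k : ℕ) : ∀ i (h : i + k < P.length),
      pathWeight (k + 1) ≤ B (P.vert ⟨i, by omega⟩) (P.edge ⟨i, by omega⟩) := by
  induction k with
  | zero =>
    intro i h
    simpa [pathWeight] using hB.le_apply hunif (P.edge_mem ⟨i, h⟩) (P.left_mem ⟨i, h⟩)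
  | succ k ih =>
    intro i h
    have h1 := ih (i + 1) (by omega)
    have hs := P.step i (by omega)
    have hi : i < P.length := by omega
    have hm := hB.le_mul₂ hunif (P.edge_mem ⟨i, hi⟩) (P.left_mem ⟨i, hi⟩) hs.1 hs.2.1.symm
    have ha := hB.add_le (P.edge_mem ⟨i, hi⟩) hs.1 hs.2.2.1 hs.2.2.2.1 hs.2.2.2.2.symm
    have hpos := hB.pos _ (P.edge_mem ⟨i, hi⟩) _ hs.1
    have hpos' := hB.pos _ (P.edge_mem ⟨i, hi⟩) _ (P.left_mem ⟨i, hi⟩)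
    change (2 * tau - 1) / (1 - pathWeight (k + 1)) ≤ _
    simp only at ha hm hpos
    rw [div_le_iff₀ (by linarith)]
    refine hm.trans (mul_le_mul_of_nonneg_left (by linarith) hpos'.le)

/-- The constant is a rational lower bound for `τ³`; this reduces the recursion to decimal
arithmetic. -/
theorem le_pathWeight_succ {k : ℕ} {a b : ℝ} (h : a ≤ pathWeight k) (hk : pathWeight k < 1)
    (hb : 0 ≤ b) (hab : b * (1 - a) ≤ 0.236066) : b ≤ pathWeight (k + 1) := by
  have := tau_lower
  rw [pathWeight, le_div_iff₀ (by linarith)]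
  nlinarith

/-- `τ²` is a fixed point of the recursion, because `τ²(1-τ²) = τ³`. -/
theorem pathWeight_nonneg_lt (k : ℕ) : 0 ≤ pathWeight k ∧ pathWeight k ≤ 1 - tau := by
  have hl := tau_lower
  have hu := tau_upper
  induction k with
  | zero => exact ⟨le_rfl, by rw [pathWeight]; linarith⟩
  | succ k ih =>
    obtain ⟨ih0, ih1⟩ := ih
    rw [pathWeight]
    have h1 : 0 < 1 - pathWeight k := by linarith
    refine ⟨div_nonneg (by linarith) h1.le, ?_⟩
    rw [div_le_iff₀ h1]
    have := tau_sq
    nlinarith [mul_nonneg (show 0 ≤ 1 - tau by linarith) (show 0 ≤ 1 - pathWeight k - tau by linarith)]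

theorem pathWeight_bounds : 0.236066 ≤ pathWeight 1 ∧ 0.30901 ≤ pathWeight 2 ∧
    0.3416 ≤ pathWeight 3 ∧ 0.3585 ≤ pathWeight 4 ∧ 0.3679 ≤ pathWeight 5 ∧
    0.3734 ≤ pathWeight 6 := by
  have hlt : ∀ k, pathWeight k < 1 := fun k => by
    have := (pathWeight_nonneg_lt k).2
    have := tau_lower
    linarith
  have h1 : 0.236066 ≤ pathWeight 1 :=
    le_pathWeight_succ (a := 0) (by simp [pathWeight]) (hlt 0) (by norm_num) (by norm_num)
  have h2 : 0.30901 ≤ pathWeight 2 := le_pathWeight_succ h1 (hlt 1) (by norm_num) (by norm_num)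
  have h3 : 0.3416 ≤ pathWeight 3 := le_pathWeight_succ h2 (hlt 2) (by norm_num) (by norm_num)
  have h4 : 0.3585 ≤ pathWeight 4 := le_pathWeight_succ h3 (hlt 3) (by norm_num) (by norm_num)
  have h5 : 0.3679 ≤ pathWeight 5 := le_pathWeight_succ h4 (hlt 4) (by norm_num) (by norm_num)
  exact ⟨h1, h2, h3, h4, h5, le_pathWeight_succ h5 (hlt 5) (by norm_num) (by norm_num)⟩

namespace IsSubnormal

variable (hB : H.IsSubnormal B) (hunif : H.IsUniform 4)
include hB hunif

theorem le_of_hasAttachedPath {e : Set α} {u : α} {m k : ℕ} (h : H.HasAttachedPath e u m)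
    (hk : k + 1 ≤ m) : B u e ≤ 1 - pathWeight (k + 1) := by
  obtain ⟨he, hu, -, P, rfl, rfl, hne, -, -⟩ := h
  have h1 := hB.pathWeight_le hunif P k 0 (by omega)
  have h2 := hB.add_le he hu (P.edge_mem ⟨0, by omega⟩) (P.left_mem ⟨0, by omega⟩) (hne _).symm
  have h4 : P.vert ⟨0, by omega⟩ = P.vert 0 := rfl
  rw [h4] at h1
  linarith

/-- Numerical bounds for the weight of an edge at the start of an attached path. -/
theorem hasAttachedPath_bounds {e : Set α} {u : α} {m : ℕ} (h : H.HasAttachedPath e u m) :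
    B u e ≤ 0.763934 ∧ (2 ≤ m → B u e ≤ 0.69099) ∧ (3 ≤ m → B u e ≤ 0.6584) ∧
      (4 ≤ m → B u e ≤ 0.6415) ∧ (5 ≤ m → B u e ≤ 0.6321) ∧ (6 ≤ m → B u e ≤ 0.6266) := by
  obtain ⟨h1, h2, h3, h4, h5, h6⟩ := pathWeight_bounds
  have key := fun k hk => hB.le_of_hasAttachedPath hunif (k := k) h hk
  refine ⟨?_, fun hm => ?_, fun hm => ?_, fun hm => ?_, fun hm => ?_, fun hm => ?_⟩
  · have := key 0 h.2.2.1; norm_num at this ⊢; linarith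
  · have := key 1 hm; norm_num at this ⊢; linarith
  · have := key 2 hm; norm_num at this ⊢; linarith
  · have := key 3 hm; norm_num at this ⊢; linarith
  · have := key 4 hm; norm_num at this ⊢; linarith
  · have := key 5 hm; norm_num at this ⊢; linarith

/-- Longer arms lower the four weights of the central edge. The minimal excluded lengths
`(2,2,2,2)`, `(1,2,3,3)`, `(1,2,2,4)`, `(1,1,5,5)` and `(1,1,4,6)` each push their product below
`τ³`. -/
theorem dagger_lengths {i j k l : ℕ} (hij : i ≤ j) (hjk : j ≤ k) (hkl : k ≤ l)
    (h : H.IsDagger i j k l) :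
    (i, j, k, l) = (1, 2, 2, 2) ∨ (i, j, k, l) = (1, 2, 2, 3) ∨
      (i, j, k, l) = (1, 1, 4, 4) ∨ (i, j, k, l) = (1, 1, 4, 5) ∨
      (i = 1 ∧ j = 1 ∧ 1 ≤ k ∧ k ≤ 3 ∧ k ≤ l) := by
  obtain ⟨-, e, he, u, hu, rfl, h0, h1, h2, h3⟩ := h
  have hm : ∀ i, u i ∈ Set.range u := fun i => ⟨i, rfl⟩
  have hne : ∀ {i j}, i ≠ j → u i ≠ u j := fun hij h => hij (hu h)
  have hprod := hB.le_mul₄ hunif he (hm 0) (hm 1) (hm 2) (hm 3) (hne (by decide)) (hne (by decide))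
    (hne (by decide)) (hne (by decide)) (hne (by decide)) (hne (by decide))
  have hp := fun i => hB.pos _ he (u i) (hm i)
  have hbound : ∀ {x y z w : ℝ}, B (u 0) (Set.range u) ≤ x → B (u 1) (Set.range u) ≤ y →
      B (u 2) (Set.range u) ≤ z → B (u 3) (Set.range u) ≤ w → 0.236066 ≤ x * y * z * w := by
    intro x y z w hx hy hz hw
    have := mul₄_le (hp 0) (hp 1) (hp 2) (hp 3) hx hy hz hw
    have := tau_lower
    linarith
  have g0 := hB.hasAttachedPath_bounds hunif h0
  have g1 := hB.hasAttachedPath_bounds hunif h1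
  have g2 := hB.hasAttachedPath_bounds hunif h2
  have g3 := hB.hasAttachedPath_bounds hunif h3
  have hi1 : 1 ≤ i := h0.2.2.1
  have hi : i = 1 := by
    by_contra hi
    have := hbound (g0.2.1 (by omega)) (g1.2.1 (by omega)) (g2.2.1 (by omega)) (g3.2.1 (by omega))
    norm_num at this
  subst hi
  simp only [Prod.mk.injEq, true_and]
  by_cases hj : j = 1
  · subst hj
    simp only [true_and]
    have hk : k ≤ 4 := by
      by_contra hk
      have := hbound g0.1 g1.1 (g2.2.2.2.2.1 (by omega)) (g3.2.2.2.2.1 (by omega))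
      norm_num at this
    have hl : k = 4 → l ≤ 5 := by
      intro hk
      by_contra hl
      have := hbound g0.1 g1.1 (g2.2.2.2.1 (by omega)) (g3.2.2.2.2.2 (by omega))
      norm_num at this
    omega
  · have hk : k ≤ 2 := by
      by_contra hk
      have := hbound g0.1 (g1.2.1 (by omega)) (g2.2.2.1 (by omega)) (g3.2.2.1 (by omega))
      norm_num at this
    have hl : l ≤ 3 := by
      by_contra hl
      have := hbound g0.1 (g1.2.1 (by omega)) (g2.2.1 (by omega)) (g3.2.2.2.1 (by omega))
      norm_num at this
    omega

/-- Three paths are attached to an edge whose fourth vertex has weight less than `τ`: their lengths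
are `1`, `1` and at most `3`. -/
theorem attached_lengths {e : Set α} (he : e ∈ H.edgeSet) {v a b c : α} {i j k : ℕ} (hv : v ∈ e)
    (hva : v ≠ a) (hvb : v ≠ b) (hvc : v ≠ c) (hab : a ≠ b) (hac : a ≠ c) (hbc : b ≠ c)
    (ht : B v e < tau) (ha : H.HasAttachedPath e a i) (hb : H.HasAttachedPath e b j)
    (hc : H.HasAttachedPath e c k) :
    ∃ u₁ u₂ u₃ : α, ∃ k : ℕ, u₁ ≠ u₂ ∧ u₁ ≠ u₃ ∧ u₂ ≠ u₃ ∧ 1 ≤ k ∧ k ≤ 3 ∧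
      H.HasAttachedPath e u₁ 1 ∧ H.HasAttachedPath e u₂ 1 ∧ H.HasAttachedPath e u₃ k := by
  have hprod := hB.le_mul₄ hunif he hv ha.2.1 hb.2.1 hc.2.1 hva hvb hvc hab hac hbc
  have hp := hB.pos e he
  -- The fourth vertex contributes less than `τ`, so it acts as an arm of unlimited length in a
  -- dagger.
  have hbound : ∀ {x y z : ℝ}, B a e ≤ x → B b e ≤ y → B c e ≤ z →
      0.236066 ≤ 0.618034 * x * y * z := by
    intro x y z hx hy hz
    have hτ := tau_upper
    have := mul₄_le (hp v hv) (hp a ha.2.1) (hp b hb.2.1) (hp c hc.2.1) (ht.trans hτ).le hx hy hz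
    have := tau_lower
    linarith
  have ga := hB.hasAttachedPath_bounds hunif ha
  have gb := hB.hasAttachedPath_bounds hunif hb
  have gc := hB.hasAttachedPath_bounds hunif hc
  have hi1 : 1 ≤ i := ha.2.2.1
  have hj1 : 1 ≤ j := hb.2.2.1
  have hk1 : 1 ≤ k := hc.2.2.1
  have hij : i ≤ 1 ∨ j ≤ 1 := by
    by_contra! h
    have := hbound (ga.2.1 (by omega)) (gb.2.1 (by omega)) gc.1
    norm_num at this
  have hik : i ≤ 1 ∨ k ≤ 1 := by
    by_contra! h
    have := hbound (ga.2.1 (by omega)) gb.1 (gc.2.1 (by omega))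
    norm_num at this
  have hjk : j ≤ 1 ∨ k ≤ 1 := by
    by_contra! h
    have := hbound ga.1 (gb.2.1 (by omega)) (gc.2.1 (by omega))
    norm_num at this
  have hi3 : i ≤ 3 := by
    by_contra! h
    have := hbound (ga.2.2.2.1 (by omega)) gb.1 gc.1
    norm_num at this
  have hj3 : j ≤ 3 := by
    by_contra! h
    have := hbound ga.1 (gb.2.2.2.1 (by omega)) gc.1
    norm_num at this
  have hk3 : k ≤ 3 := by
    by_contra! h
    have := hbound ga.1 gb.1 (gc.2.2.2.1 (by omega))
    norm_num at this
  by_cases h1 : i = 1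
  · subst h1
    by_cases h2 : j = 1
    · subst h2
      exact ⟨a, b, c, k, hab, hac, hbc, hk1, hk3, ha, hb, hc⟩
    · have : k = 1 := by omega
      subst this
      exact ⟨a, c, b, j, hac, hab, hbc.symm, hj1, hj3, ha, hc, hb⟩
  · have h2 : j = 1 := by omega
    have h3 : k = 1 := by omega
    subst h2 h3
    exact ⟨b, c, a, i, hbc, hab.symm, hac.symm, hi1, hi3, hb, hc, ha⟩

end IsSubnormal

theorem IsFullEdge.degree_le_two {e : Set α} (he : H.IsFullEdge e) (hB : H.IsSubnormal B)
    (hunif : H.IsUniform 4) {v : α} (hv : v ∈ e) : H.degree v ≤ 2 := by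
  by_contra! h
  obtain ⟨a, ha, hav⟩ := hunif.exists_ne₁ he.1 v
  obtain ⟨b, hb, hbv, hba⟩ := hunif.exists_ne₂ he.1 v a
  obtain ⟨c, hc, hcv, hca, hcb⟩ := hunif.exists_ne₃ he.1 v a b
  exact hB.false_of_degrees_3222 hunif he.1 hv ha hb hc hav.symm hbv.symm hcv.symm hba.symm
    hca.symm hcb.symm h (he.2 a ha) (he.2 b hb) (he.2 c hc)

/-! ### Daggers -/

theorem IsSubnormal.exists_isDagger (hB : H.IsSubnormal B) (hfin : H.vertexSet.Finite)
    (hunif : H.IsUniform 4) (hconn : H.IsConnected) (hac : ¬ H.HasCycle) {e : Set α}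
    (he : H.IsFullEdge e) (hlow : ∀ u ∈ e, ∀ f ∈ H.edgeSet, u ∈ f → f ≠ e → Low B (u, f)) :
    ∃ i j k l : ℕ, 1 ≤ i ∧ i ≤ j ∧ j ≤ k ∧ k ≤ l ∧ H.IsDagger i j k l := by
  obtain ⟨a, b, c, d, ha, hb, hc, hd, hab, hac', had, hbc, hbd, hcd⟩ := hunif.exists_four he.1
  have heq := hunif.eq_of_mem he.1 ha hb hc hd hab hac' had hbc hbd hcd
  let u : Fin 4 → α := ![a, b, c, d]
  have hmem : ∀ i, u i ∈ e := by intro i; fin_cases i <;> assumption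
  have hinj : Function.Injective u := by
    intro i j h
    fin_cases i <;> fin_cases j <;> simp [u, hab, hac', had, hbc, hbd, hcd, hab.symm, hac'.symm,
      had.symm, hbc.symm, hbd.symm, hcd.symm] at h ⊢
  have hatt : ∀ i, ∃ m, H.HasAttachedPath e (u i) m := by
    intro i
    obtain ⟨f, hf, huf, hfe⟩ := exists_edge_ne (he.2 _ (hmem i)) e
    exact hB.exists_hasAttachedPath hfin hunif hac he (hmem i)
      (le_antisymm (he.degree_le_two hB hunif (hmem i)) (he.2 _ (hmem i))) hf huf
      (hlow _ (hmem i) f hf huf hfe)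
  choose m hm using hatt
  -- The arms are relabelled by increasing length.
  let σ := Tuple.sort m
  have hmono : Monotone (m ∘ σ) := Tuple.monotone_sort m
  refine ⟨m (σ 0), m (σ 1), m (σ 2), m (σ 3), (hm _).2.2.1, hmono (by decide), hmono (by decide),
    hmono (by decide), hconn, e, he.1, u ∘ σ, hinj.comp σ.injective, ?_, hm _, hm _, hm _, hm _⟩
  rw [σ.surjective.range_comp, heq]
  ext x
  simp only [Set.mem_range, Fin.exists_fin_succ, u]
  simp [eq_comm]

/-! ### Order along a path -/

theorem Path.step_reverse (P : H.Path) (i : ℕ) (hi : i + 1 < P.length) :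
    H.Step (P.vert ⟨i + 2, by omega⟩, P.edge ⟨i + 1, hi⟩)
      (P.vert ⟨i + 1, by omega⟩, P.edge ⟨i, by omega⟩) := by
  refine ⟨P.left_mem ⟨i + 1, hi⟩, fun h => ?_, P.edge_mem _, P.right_mem ⟨i, by omega⟩, fun h => ?_⟩
  · have := P.vert_injective h; simp at this
  · have := P.edge_injective h; simp at this

theorem Path.OccursAt.le {P : H.Path} {x : α ⊕ Set α} {c : ℕ} (h : P.OccursAt x c) :
    c ≤ 2 * P.length := by
  rcases x with v | e
  · obtain ⟨i, -, rfl⟩ := h; have := i.2; omega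
  · obtain ⟨i, -, rfl⟩ := h; have := i.2; omega

theorem Path.OccursAt.unique {P : H.Path} {x y : α ⊕ Set α} {c : ℕ} (hx : P.OccursAt x c)
    (hy : P.OccursAt y c) : x = y := by
  rcases x with v | e <;> rcases y with w | f <;> obtain ⟨i, rfl, hi⟩ := hx <;>
    obtain ⟨j, rfl, hj⟩ := hy
  · rw [show i = j from Fin.ext (by omega)]
  · omega
  · omega
  · rw [show i = j from Fin.ext (by omega)]

theorem IsMajorBranching.isBranching {x : α ⊕ Set α} (hx : H.IsMajorBranching x) :
    H.IsBranching x := by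
  rcases x with v | e
  · exact ⟨3, hx⟩
  · exact ⟨4, hx⟩

namespace IsSubnormal

variable (hB : H.IsSubnormal B) (hunif : H.IsUniform 4)
include hB hunif

theorem low_path_forward {P : H.Path} {i : ℕ} (hi : i < P.length)
    (hlow : Low B (P.vert ⟨i, by omega⟩, P.edge ⟨i, hi⟩)) (d : ℕ) (hd : i + d < P.length) :
    Low B (P.vert ⟨i + d, by omega⟩, P.edge ⟨i + d, hd⟩) := by
  induction d with
  | zero => exact hlow
  | succ d ih =>
    exact hB.low_step hunif ⟨P.edge_mem _, P.left_mem ⟨i + d, by omega⟩⟩ (ih (by omega))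
      (P.step (i + d) hd)

theorem low_path_backward {P : H.Path} {i d : ℕ} (hi : i + d < P.length)
    (hlow : Low B (P.vert ⟨i + d + 1, by omega⟩, P.edge ⟨i + d, hi⟩)) :
    Low B (P.vert ⟨i + 1, by omega⟩, P.edge ⟨i, by omega⟩) := by
  induction d with
  | zero => exact hlow
  | succ d ih =>
    exact ih (by omega) (hB.low_step hunif ⟨P.edge_mem _, P.right_mem ⟨i + (d + 1), hi⟩⟩ hlow
      (P.step_reverse (i + d) hi))

/-- A low flag pointing towards `x` would stay low along `P` as far as `x`, where nothing can
branch. `not_low_after` is the same for the opposite direction. -/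
theorem not_low_before (hfin : H.vertexSet.Finite) {P : H.Path} {x : α ⊕ Set α}
    (hx : H.IsBranching x) {c : ℕ} (hc : P.OccursAt x c) {i : ℕ} (hi : i < P.length)
    (hic : 2 * i < c) : ¬ Low B (P.vert ⟨i, by omega⟩, P.edge ⟨i, hi⟩) := by
  intro hlow
  rcases x with v | e
  · obtain ⟨⟨j, hj⟩, rfl, rfl⟩ := hc
    obtain ⟨k, hk⟩ := hx
    obtain ⟨d, rfl⟩ : ∃ d, j = i + d + 1 := ⟨j - i - 1, by simp only at hic; omega⟩
    have h := hB.low_path_forward hunif hi hlow d (by omega)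
    have hs : P.vert ⟨i + d + 1, hj⟩ ≠ P.vert ⟨i + d, by omega⟩ := fun h => by
      have := P.vert_injective h; simp at this
    have := hB.low_degree_le_two hunif (P.edge_mem _) (P.left_mem ⟨i + d, by omega⟩) h
      (P.right_mem ⟨i + d, by omega⟩) hs
    have h3 := hk.2.1
    have h4 := hk.2.2
    simp only [Fin.succ_mk] at this
    omega
  · obtain ⟨⟨j, hj⟩, rfl, rfl⟩ := hc
    obtain ⟨k, hk⟩ := hx
    obtain ⟨d, rfl⟩ : ∃ d, j = i + d := ⟨j - i, by simp only at hic; omega⟩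
    exact hB.not_isBranchingEdge_of_low hfin hunif (P.left_mem ⟨i + d, hj⟩)
      (hB.low_path_forward hunif hi hlow d (by omega)) k hk

theorem not_low_after (hfin : H.vertexSet.Finite) {P : H.Path} {x : α ⊕ Set α}
    (hx : H.IsBranching x) {c : ℕ} (hc : P.OccursAt x c) {i : ℕ} (hi : i < P.length)
    (hic : c < 2 * i + 2) : ¬ Low B (P.vert ⟨i + 1, by omega⟩, P.edge ⟨i, hi⟩) := by
  intro hlow
  rcases x with v | e
  · obtain ⟨⟨j, hj⟩, rfl, rfl⟩ := hc
    obtain ⟨k, hk⟩ := hx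
    obtain ⟨d, rfl⟩ : ∃ d, i = j + d := ⟨i - j, by simp only at hic; omega⟩
    have h := hB.low_path_backward hunif hi hlow
    have hs : P.vert ⟨j, hj⟩ ≠ P.vert ⟨j + 1, by omega⟩ := fun h => by
      have := P.vert_injective h; simp at this
    have := hB.low_degree_le_two hunif (P.edge_mem _) (P.right_mem ⟨j, by omega⟩) h
      (P.left_mem ⟨j, by omega⟩) hs
    have h3 := hk.2.1
    have h4 := hk.2.2
    simp only [Fin.castSucc_mk] at this
    omega
  · obtain ⟨⟨j, hj⟩, rfl, rfl⟩ := hc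
    obtain ⟨k, hk⟩ := hx
    obtain ⟨d, rfl⟩ : ∃ d, i = j + d := ⟨i - j, by simp only at hic; omega⟩
    exact hB.not_isBranchingEdge_of_low hfin hunif (P.right_mem ⟨j, hj⟩)
      (hB.low_path_backward hunif hi hlow) k hk

/-- The directions from `y` towards `x` and towards `z` are both not low. Neither a vertex of degree
3 nor a full edge allows two such directions. -/
theorem not_inOrder (hfin : H.vertexSet.Finite) (P : H.Path) {x y z : α ⊕ Set α}
    (hx : H.IsBranching x) (hy : H.IsMajorBranching y) (hz : H.IsBranching z) :
    ¬ P.InOrder x y z := by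
  rintro ⟨a, b, c, ha, hb, hc, hab, hbc⟩
  have hcl := hc.le
  rcases y with v | e
  · obtain ⟨⟨j, hj⟩, rfl, rfl⟩ := hb
    simp only at hab hbc
    obtain ⟨i, rfl⟩ : ∃ i, j = i + 1 := ⟨j - 1, by omega⟩
    have hi : i < P.length := by omega
    have hi' : i + 1 < P.length := by omega
    have h1 := hB.not_low_after hunif hfin hx ha hi (by omega)
    have h2 := hB.not_low_before hunif hfin hz hc hi' (by omega)
    refine hB.false_of_not_low₂ hunif hy.2.2.ge (P.edge_mem ⟨i, hi⟩) (P.right_mem ⟨i, hi⟩)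
      (P.edge_mem ⟨i + 1, hi'⟩) (P.left_mem ⟨i + 1, hi'⟩) (fun h => ?_) h1 h2
    have := P.edge_injective h; simp at this
  · obtain ⟨⟨j, hj⟩, rfl, rfl⟩ := hb
    simp only at hab hbc
    have hfull := hy.isFullEdge hfin hunif
    have hnb : ∀ w ∈ P.edge ⟨j, hj⟩, ¬ H.IsBranching (.inl w) := fun w hw ⟨k, hk⟩ =>
      hy.2.2.1 w hw k hk
    -- A branching edge contains no branching vertex, so `x` and `z` lie beyond its two end vertices
    -- and there is a neighbouring edge on each side.
    have ha' : a ≠ 2 * j := by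
      rintro rfl
      refine hnb _ (P.left_mem ⟨j, hj⟩) ?_
      rwa [← ha.unique (y := .inl (P.vert (Fin.castSucc ⟨j, hj⟩))) ⟨_, rfl, rfl⟩]
    have hc' : c ≠ 2 * j + 2 := by
      rintro rfl
      refine hnb _ (P.right_mem ⟨j, hj⟩) ?_
      rwa [← hc.unique (y := .inl (P.vert (Fin.succ ⟨j, hj⟩))) ⟨_, rfl, rfl⟩]
    obtain ⟨i, rfl⟩ : ∃ i, j = i + 1 := ⟨j - 1, by omega⟩
    have hi : i < P.length := by omega
    have hi' : i + 1 + 1 < P.length := by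
      have : c ≠ 2 * P.length ∨ i + 1 + 1 < P.length := by
        by_contra! h
        omega
      omega
    have h1 := hB.not_low_after hunif hfin hx ha hi (by omega)
    have h2 := hB.not_low_before hunif hfin hz hc hi' (by omega)
    refine hB.false_of_lt_tau₂_full hunif hfull (P.left_mem ⟨i + 1, hj⟩)
      (P.right_mem ⟨i + 1, hj⟩) (fun h => ?_)
      (hB.lt_tau_of_not_low hfull.1 (P.left_mem ⟨i + 1, hj⟩) (P.edge_mem ⟨i, hi⟩)
        (P.right_mem ⟨i, hi⟩) (fun h => ?_) h1)
      (hB.lt_tau_of_not_low hfull.1 (P.right_mem ⟨i + 1, hj⟩) (P.edge_mem ⟨i + 1 + 1, hi'⟩)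
        (P.left_mem ⟨i + 1 + 1, hi'⟩) (fun h => ?_) h2)
    · have := P.vert_injective h; simp at this
    · have := P.edge_injective h; simp at this
    · have := P.edge_injective h; simp at this

theorem encard_isMajorBranching_le_two (hfin : H.vertexSet.Finite) {P : H.Path}
    (hP : ∀ x, H.IsBranching x → ∃ k, P.OccursAt x k) :
    {x | H.IsMajorBranching x}.encard ≤ 2 := by
  by_contra! hcon
  have h3 : (3 : ℕ∞) ≤ {x | H.IsMajorBranching x}.encard := by
    have := Order.add_one_le_of_lt hcon
    norm_num at this
    exact this
  obtain ⟨t, ht, ht3⟩ := Set.exists_subset_encard_eq h3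
  obtain ⟨x, y, z, hxy, hxz, hyz, rfl⟩ := Set.encard_eq_three.1 ht3
  have hx : H.IsMajorBranching x := ht (by simp)
  have hy : H.IsMajorBranching y := ht (by simp)
  have hz : H.IsMajorBranching z := ht (by simp)
  have hx' := hx.isBranching
  have hy' := hy.isBranching
  have hz' := hz.isBranching
  obtain ⟨a, ha⟩ := hP x hx'
  obtain ⟨b, hb⟩ := hP y hy'
  obtain ⟨c, hc⟩ := hP z hz'
  have hab : a ≠ b := fun h => hxy (ha.unique (h ▸ hb))
  have hac : a ≠ c := fun h => hxz (ha.unique (h ▸ hc))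
  have hbc : b ≠ c := fun h => hyz (hb.unique (h ▸ hc))
  rcases lt_or_gt_of_ne hab with h1 | h1 <;> rcases lt_or_gt_of_ne hac with h2 | h2 <;>
    rcases lt_or_gt_of_ne hbc with h3 | h3
  · exact hB.not_inOrder hunif hfin P hx' hy hz' ⟨a, b, c, ha, hb, hc, h1, h3⟩
  · exact hB.not_inOrder hunif hfin P hx' hz hy' ⟨a, c, b, ha, hc, hb, h2, h3⟩
  · omega
  · exact hB.not_inOrder hunif hfin P hz' hx hy' ⟨c, a, b, hc, ha, hb, h2, h1⟩
  · exact hB.not_inOrder hunif hfin P hy' hx hz' ⟨b, a, c, hb, ha, hc, h1, h2⟩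
  · omega
  · exact hB.not_inOrder hunif hfin P hy' hz hx' ⟨b, c, a, hb, hc, ha, h3, h2⟩
  · exact hB.not_inOrder hunif hfin P hz' hy hx' ⟨c, b, a, hc, hb, ha, h3, h1⟩

/-! ### The path through all branchings -/

/-- From a full edge one follows flags that are not low for as long as possible. The successor is
unique at each stage, so every flag off this walk reached from its start is low and hence carries no
branching. -/
theorem exists_path_isBranching (hfin : H.vertexSet.Finite) (hconn : H.IsConnected)
    (hac : ¬ H.HasCycle) {e₀ : Set α} (he₀ : H.IsFullEdge e₀) {u₀ : α} {g₀ : Set α}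
    (hu₀ : u₀ ∈ e₀) (hg₀ : g₀ ∈ H.edgeSet) (hug₀ : u₀ ∈ g₀) (hge₀ : g₀ ≠ e₀)
    (hlow₀ : ¬ Low B (u₀, g₀)) :
    ∃ P : H.Path, ∀ x, H.IsBranching x → ∃ k, P.OccursAt x k := by
  classical
  obtain ⟨a, ha, hau₀⟩ := hunif.exists_ne₁ he₀.1 u₀
  obtain ⟨F, M, hF, h0, hQ, hmax⟩ := exists_maximal_flagWalk hfin hunif hac (fun p => ¬ Low B p)
    (p := (a, e₀)) ⟨he₀.1, ha⟩
  have hM : 0 < M := by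
    by_contra hM
    have : M = 0 := by omega
    subst this
    exact hmax (u₀, g₀) hlow₀ (by rw [h0]; exact ⟨hu₀, hau₀.symm, hg₀, hug₀, hge₀⟩)
  -- A low flag pointing backwards would propagate back to the full edge `e₀`.
  have hback : ∀ i < M, ¬ Low B ((F (i + 1)).1, (F i).2) := by
    intro i hi
    induction i with
    | zero =>
      have := (hF.2 0 hi).1
      rw [h0] at this ⊢
      exact hB.not_low_of_isFullEdge hunif he₀ this
    | succ i ih =>
      intro hlow
      have hs := hF.2 i (by omega)
      have hs' := hF.2 (i + 1) hi
      exact ih (by omega) (hB.low_step hunif (p := ((F (i + 1 + 1)).1, (F (i + 1)).2))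
        ⟨hs.2.2.1, hs'.1⟩ hlow
        ⟨hs.2.2.2.1, hs'.2.1.symm, (hF.isFlag (by omega)).1, hs.1, hs.2.2.2.2.symm⟩)
  have hentry : ∀ i < M, B (F (i + 1)).1 (F (i + 1)).2 < tau := by
    intro i hi
    have hs := hF.2 i hi
    exact hB.lt_tau_of_not_low hs.2.2.1 hs.2.2.2.1 (hF.isFlag hi.le).1 hs.1 hs.2.2.2.2.symm
      (hback i hi)
  have hexit : ∀ i ≤ M, ∀ q, H.Step (F i) q → ¬ Low B q → B q.1 (F i).2 < tau := by
    intro i hi q hq hlow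
    exact hB.lt_tau_of_not_low (hF.isFlag hi).1 hq.1 hq.2.2.1 hq.2.2.2.1 hq.2.2.2.2 hlow
  -- Two exit vertices would give `e₀` two weights below `τ`, or a later edge three, counting its
  -- entry. Two edges at the same exit vertex would give a vertex of degree 3 with two flags that
  -- are not low, one of them pointing backwards.
  have hsucc : ∀ i ≤ M, ∀ q, H.Step (F i) q → ¬ Low B q → i < M ∧ q = F (i + 1) := by
    intro i hi q hq hlow
    have hiM : i < M := by
      by_contra h
      have : i = M := by omega
      subst this
      exact hmax q hlow hq
    refine ⟨hiM, ?_⟩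
    have hs := hF.2 i hiM
    have hv : q.1 = (F (i + 1)).1 := by
      by_contra hne
      have h1 := hexit i hi q hq hlow
      have h2 := hexit i hi _ hs (hQ i hiM)
      rcases Nat.eq_zero_or_pos i with rfl | hpos
      · have hq1 := hq.1
        have hs1 := hs.1
        rw [h0] at hq1 hs1 h1 h2
        exact hB.false_of_lt_tau₂_full hunif he₀ hq1 hs1 hne h1 h2
      · obtain ⟨j, rfl⟩ := Nat.exists_eq_succ_of_ne_zero hpos.ne'
        exact hB.false_of_lt_tau₃ hunif (hF.isFlag hi).1 (hF.isFlag hi).2 hq.1 hs.1 hq.2.1.symm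
          hs.2.1.symm hne (hentry j (by omega)) h1 h2
    refine Prod.ext hv ?_
    by_contra hne
    have hd := three_le_degree hfin (hF.isFlag hi).1 hs.1 hs.2.2.1 hs.2.2.2.1 hq.2.2.1
      (hv ▸ hq.2.2.2.1) hs.2.2.2.2.symm hq.2.2.2.2.symm (Ne.symm hne)
    refine hB.false_of_not_low₂ hunif hd (hF.isFlag hi).1 hs.1 hs.2.2.1 hs.2.2.2.1
      hs.2.2.2.2.symm (hback i hiM) (hQ i hiM)
  have hinv : ∀ p q, H.IsFlag p → p.1 = a → H.Reach p q → Low B q ∨ ∃ i ≤ M, q = F i := by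
    intro p q hp hpa hr
    induction hr with
    | refl =>
      by_cases hpe : p.2 = e₀
      · exact Or.inr ⟨0, Nat.zero_le _, by rw [h0]; exact Prod.ext hpa hpe⟩
      -- A flag at `a` outside `e₀` that is not low would give `e₀` a second weight below `τ`,
      -- besides the one at the exit of the walk.
      · left
        by_contra hlow
        have hs := hF.2 0 hM
        have h1 := hexit 0 (Nat.zero_le _) _ hs (hQ 0 hM)
        rw [h0] at hs h1
        exact hB.false_of_lt_tau₂_full hunif he₀ ha hs.1 hs.2.1.symm
          (hB.lt_tau_of_not_low he₀.1 ha hp.1 (hpa ▸ hp.2) hpe (by rw [← hpa]; exact hlow)) h1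
    | @tail q r hr hs ih =>
      rcases ih with hlow | ⟨i, hi, rfl⟩
      · exact Or.inl (hB.low_step hunif (Reach.isFlag hr hp) hlow hs)
      · by_cases hlow : Low B r
        · exact Or.inl hlow
        · obtain ⟨hiM, rfl⟩ := hsucc i hi r hs hlow
          exact Or.inr ⟨i + 1, hiM, rfl⟩
  have haV : a ∈ H.vertexSet := H.subset_vertexSet_of_mem_edgeSet' he₀.1 ha
  have hdeg3 : ∀ v, H.IsBranching (.inl v) → 3 ≤ H.degree v := by
    rintro v ⟨k, -, hk, rfl⟩
    exact hk
  have hτ : ∀ v, H.IsBranching (.inl v) → ∀ g ∈ H.edgeSet, v ∈ g → B v g < tau := by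
    intro v hv g hg hvg
    have := hB.le_of_three_le_degree hunif hg hvg (hdeg3 v hv)
    have := tau_lower
    linarith
  have hvertex : ∀ v, H.IsBranching (.inl v) →
      (∃ i < M, v = (F (i + 1)).1) ∨ (v ∈ (F M).2 ∧ v ≠ (F M).1) := by
    intro v hv
    have hvV : v ∈ H.vertexSet := by obtain ⟨k, hk⟩ := hv; exact hk.1
    have h3 := hdeg3 v hv
    have hva : a ≠ v := by
      rintro rfl
      have := he₀.degree_le_two hB hunif ha
      omega
    obtain ⟨p, q, hp, hpa, hr, hq, hvq, hvq'⟩ := hconn.exists_reach_vertex haV hvV hva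
    rcases hinv p q hp hpa hr with hlow | ⟨i, hi, rfl⟩
    · have := hB.low_degree_le_two hunif hq.1 hq.2 hlow hvq hvq'
      omega
    · rcases hi.lt_or_eq with hiM | rfl
      · refine Or.inl ⟨i, hiM, ?_⟩
        by_contra hne
        have hs := hF.2 i hiM
        have h2 := hexit i hi _ hs (hQ i hiM)
        rcases Nat.eq_zero_or_pos i with rfl | hpos
        · rw [h0] at hvq
          have := he₀.degree_le_two hB hunif hvq
          omega
        · obtain ⟨j, rfl⟩ := Nat.exists_eq_succ_of_ne_zero hpos.ne'
          exact hB.false_of_lt_tau₃ hunif hq.1 hq.2 hvq hs.1 hvq'.symm hs.2.1.symm hne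
            (hentry j (by omega)) (hτ v hv _ hq.1 hvq) h2
      · exact Or.inr ⟨hvq, hvq'⟩
  -- The walk leaves the endpoint in its last edge free. It is chosen to be a branching vertex if
  -- one is there; two would give that edge three weights below `τ`.
  obtain ⟨z, hz, hz', hzu⟩ : ∃ z ∈ (F M).2, z ≠ (F M).1 ∧
      ∀ v ∈ (F M).2, v ≠ (F M).1 → H.IsBranching (.inl v) → v = z := by
    have hfl := hF.isFlag le_rfl
    by_cases h : ∃ v ∈ (F M).2, v ≠ (F M).1 ∧ H.IsBranching (.inl v)
    · obtain ⟨z, hz, hz', hbr⟩ := h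
      refine ⟨z, hz, hz', fun v hv hv' hvb => ?_⟩
      by_contra hne
      obtain ⟨j, rfl⟩ := Nat.exists_eq_succ_of_ne_zero hM.ne'
      exact hB.false_of_lt_tau₃ hunif hfl.1 hfl.2 hz hv hz'.symm hv'.symm (Ne.symm hne)
        (hentry j (by omega)) (hτ z hbr _ hfl.1 hz) (hτ v hvb _ hfl.1 hv)
    · obtain ⟨z, hz, hz'⟩ := hunif.exists_ne₁ hfl.1 (F M).1
      exact ⟨z, hz, hz', fun v hv hv' hvb => absurd ⟨v, hv, hv', hvb⟩ h⟩
  obtain ⟨P, hP, hvert, hedge, hlast⟩ := hF.exists_path hac hz hz'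
  refine ⟨P, fun x hx => ?_⟩
  rcases x with v | e
  · rcases hvertex v hx with ⟨i, hi, rfl⟩ | ⟨hv, hv'⟩
    · exact ⟨_, Fin.castSucc ⟨i + 1, by omega⟩, hvert _, rfl⟩
    · exact ⟨_, Fin.last _, hlast.trans (hzu v hv hv' hx).symm, rfl⟩
  · obtain ⟨k, hk⟩ := hx
    obtain ⟨p, q, hp, hpa, hr, hq, rfl⟩ := hconn.exists_reach_edge hunif haV hk.1
    rcases hinv p q hp hpa hr with hlow | ⟨i, hi, rfl⟩
    · exact absurd hk (hB.not_isBranchingEdge_of_low hfin hunif hq.2 hlow k)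
    · exact ⟨_, ⟨i, by omega⟩, hedge _, rfl⟩

/-- A hypertree with a full edge in which no full edge is the centre of a dagger is an open
quipu. -/
theorem isOpenQuipu (hfin : H.vertexSet.Finite) (hconn : H.IsConnected) (hac : ¬ H.HasCycle)
    {e₀ : Set α} (he₀ : H.IsFullEdge e₀)
    (hout : ∀ e, H.IsFullEdge e → ∃ u ∈ e, ∃ f ∈ H.edgeSet, u ∈ f ∧ f ≠ e ∧ ¬ Low B (u, f)) :
    H.IsOpenQuipu := by
  obtain ⟨u₀, hu₀, g₀, hg₀, hug₀, hge₀, hlow₀⟩ := hout e₀ he₀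
  obtain ⟨P, hP⟩ := hB.exists_path_isBranching hunif hfin hconn hac he₀ hu₀ hg₀ hug₀ hge₀ hlow₀
  refine ⟨⟨hconn, hac⟩, ⟨P, hP, fun x y z hx hy hz => hB.not_inOrder hunif hfin P hx hy hz⟩,
    hB.encard_isMajorBranching_le_two hunif hfin hP, fun e he => ?_⟩
  have hfull := he.isFullEdge hfin hunif
  obtain ⟨v, hv, g, hg, hvg, hge, hlow⟩ := hout e hfull
  have hvt := hB.lt_tau_of_not_low he.1 hv hg hvg hge hlow
  -- The direction out of `e` at `v` is not low and a full edge allows only one such, so the other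
  -- three vertices carry bare paths.
  have hatt : ∀ w ∈ e, w ≠ v → ∃ m, H.HasAttachedPath e w m := by
    intro w hw hwv
    obtain ⟨f, hf, hwf, hfe⟩ := exists_edge_ne (hfull.2 w hw) e
    refine hB.exists_hasAttachedPath hfin hunif hac hfull hw (he.degree_eq_two hfin hunif hw) hf
      hwf ?_
    by_contra hlow'
    exact hB.false_of_lt_tau₂_full hunif hfull hw hv hwv
      (hB.lt_tau_of_not_low he.1 hw hf hwf hfe hlow') hvt
  obtain ⟨a, ha, hav⟩ := hunif.exists_ne₁ he.1 v
  obtain ⟨b, hb, hbv, hba⟩ := hunif.exists_ne₂ he.1 v a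
  obtain ⟨c, hc, hcv, hca, hcb⟩ := hunif.exists_ne₃ he.1 v a b
  obtain ⟨i, hi⟩ := hatt a ha hav
  obtain ⟨j, hj⟩ := hatt b hb hbv
  obtain ⟨k, hk⟩ := hatt c hc hcv
  exact hB.attached_lengths hunif he.1 hv hav.symm hbv.symm hcv.symm hba.symm hca.symm hcb.symm hvt
    hi hj hk

end IsSubnormal

end Hypergraph

/-! ### Assembly of the main theorem -/

theorem theorem2 {α : Type*} (H : Hypergraph α) (hfin : H.vertexSet.Finite)
    (hunif : H.IsUniform 4) (hconn : H.IsConnected) (hirr : H.IsIrreducible)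
    (hrho : H.spectralRadius 4 ≤ 6 * (2 + Real.sqrt 5) ^ (1 / 4 : ℝ)) :
    H.IsHypertree ∧
    (∀ v ∈ H.vertexSet, H.degree v ≤ 3) ∧
    (∀ e ∈ H.edgeSet, H.edgeDegree e ≤ 4) ∧
    (H.IsOpenQuipu ∨
      ∃ i j k l : ℕ, 1 ≤ i ∧ i ≤ j ∧ j ≤ k ∧ k ≤ l ∧ H.IsDagger i j k l) ∧
    (∀ i j k l : ℕ, i ≤ j → j ≤ k → k ≤ l → H.IsDagger i j k l →
      (i, j, k, l) = (1, 2, 2, 2) ∨ (i, j, k, l) = (1, 2, 2, 3) ∨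
      (i, j, k, l) = (1, 1, 4, 4) ∨ (i, j, k, l) = (1, 1, 4, 5) ∨
      (i = 1 ∧ j = 1 ∧ 1 ≤ k ∧ k ≤ 3 ∧ k ≤ l)) := by
  obtain ⟨B, hB⟩ :=
    Hypergraph.exists_isSubnormal hfin hunif hconn hirr.edgeSet_nonempty hrho
  obtain ⟨e₀, he₀⟩ := hB.exists_isFullEdge hfin hunif hirr
  have hac := hB.not_hasCycle hunif hfin hconn he₀
  have h3 : ∀ v ∈ H.vertexSet, H.degree v ≤ 3 := fun v hv =>
    hB.degree_le_three hunif hconn he₀ hv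
  refine ⟨⟨hconn, hac⟩, h3, fun e he => hB.edgeDegree_le_four hunif hfin h3 he, ?_,
    fun i j k l hij hjk hkl h => hB.dagger_lengths hunif hij hjk hkl h⟩
  -- A full edge with only low directions is the centre of a dagger; otherwise each full edge has a
  -- direction that is not low, as the quipu argument needs.
  by_cases hdag : ∃ e, H.IsFullEdge e ∧
      ∀ u ∈ e, ∀ f ∈ H.edgeSet, u ∈ f → f ≠ e → Hypergraph.Low B (u, f)
  · obtain ⟨e, he, hlow⟩ := hdag
    exact Or.inr (hB.exists_isDagger hfin hunif hconn hac he hlow)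
  · push Not at hdag
    exact Or.inl (hB.isOpenQuipu hunif hfin hconn hac he₀ hdag)
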